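/- Let $\Phi$ be a real $m\times N$ matrix whose columns $\phi_1,\dots,\phi_N$ have Euclidean norm $1$, and let $1\le k\le N$ be an integer. For $i\ne j$ put $\mu_{i,j}=|\langle\phi_i,\phi_j\rangle|$, let $\mu=\max_{i\ne j}\mu_{i,j}$ be the mutual coherence and $\bar\mu^2=\max_{1\le j\le N}\frac1{N-1}\sum_{i\ne j}\mu_{i,j}^2$ the mean square coherence of $\Phi$ (both are $0$ if $N=1$). Let $\|\cdot\|$ denote the spectral norm (largest singular value) and $\log$ the natural logarithm. Let $\delta\in\mathbb R$, let $$0<\epsilon<\min\{1/k,\;e^{1-1/\log 2}\},$$ and suppose that $a,b,c\in(0,1)$ satisfy $$k\mu^4\le\frac1{\log^2(1/\epsilon)}\min\Big(\frac{(1-a)^2b^2}{32\,\log(2k)\,\log(e/\epsilon)},\;c^2\Big),\qquad k\bar\mu^2\le\frac{ab}{\log(1/\epsilon)},$$ $$\sqrt b+\sqrt{2ab}+\sqrt c+\frac{2k}{N}\|\Phi\|^2\le\frac{e^{-1/4}\,\delta}{6\sqrt2}.$$ Then $\Phi$ is $(k,\delta,\epsilon)$-StRIP: if $I$ is a $k$-subset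 of $\{1,\dots,N\}$ chosen uniformly at random and $\Phi_I$ is the $m\times k$ submatrix of $\Phi$ formed of the columns with indices in $I$, then $$P\big(\|\Phi_I^T\Phi_I-\mathrm{Id}\|\ge\delta\big)<\epsilon .$$ -/

import Mathlib

namespace StRIP

section Norm

open scoped Matrix.Norms.L2Operator

/-- The spectral norm of a real matrix: its largest singular value, that is, the norm of the
operator it defines between Euclidean spaces. -/
noncomputable def specNorm {m n : Type*} [Fintype m] [Fintype n] [DecidableEq n]
    (A : Matrix m n ℝ) : ℝ :=
  ‖A‖

end Norm

/-- The coherence of columns `i` and `j`: the absolute value of their inner product. -/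
noncomputable def coh {m N : ℕ} (Φ : Matrix (Fin m) (Fin N) ℝ) (i j : Fin N) : ℝ :=
  |∑ t, Φ t i * Φ t j|

/-- Mutual coherence: the largest coherence of two different columns
(`0` if there are no two different columns). -/
noncomputable def mutualCoherence {m N : ℕ} (Φ : Matrix (Fin m) (Fin N) ℝ) : ℝ :=
  ⨆ p : {p : Fin N × Fin N // p.1 ≠ p.2}, coh Φ p.1.1 p.1.2

/-- Mean square coherence: the largest, over the columns `j`, of the average of the squared
coherences of `j` with the other columns. -/
noncomputable def meanSqCoherence {m N : ℕ} (Φ : Matrix (Fin m) (Fin N) ℝ) : ℝ :=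
  ⨆ j : Fin N, 1 / ((N : ℝ) - 1) * ∑ i ∈ Finset.univ.erase j, coh Φ i j ^ 2

/-- All columns have Euclidean norm `1`. -/
def UnitColumns {m N : ℕ} (Φ : Matrix (Fin m) (Fin N) ℝ) : Prop :=
  ∀ j, ∑ t, Φ t j ^ 2 = 1

/-- The submatrix formed of the columns with indices in `I`. -/
def colSub {m N : ℕ} (Φ : Matrix (Fin m) (Fin N) ℝ) (I : Finset (Fin N)) :
    Matrix (Fin m) I ℝ :=
  Φ.submatrix id (fun i : I => (i : Fin N))

/-- The deviation of the Gram matrix of the columns in `I` from the identity. -/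
noncomputable def gramDev {m N : ℕ} (Φ : Matrix (Fin m) (Fin N) ℝ) (I : Finset (Fin N)) : ℝ :=
  specNorm ((colSub Φ I).transpose * colSub Φ I - 1)

/-- The probability of the event `E` for a uniformly random `k`-subset of the `N` indices. -/
noncomputable def probSubset (N k : ℕ) (E : Set (Finset (Fin N))) : ℝ :=
  open Classical in
  (((Finset.powersetCard k (Finset.univ : Finset (Fin N))).filter (fun I => I ∈ E)).card : ℝ) /
    ((Finset.powersetCard k (Finset.univ : Finset (Fin N))).card : ℝ)

/-- The `(k, δ, ε)` statistical restricted isometry property. -/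
def IsStRIP {m N : ℕ} (Φ : Matrix (Fin m) (Fin N) ℝ) (k : ℕ) (δ ε : ℝ) : Prop :=
  probSubset N k {I | δ ≤ gramDev Φ I} < ε

end StRIP

/-!
With high probability no column of a random `k`-subset `I` is strongly correlated with the others:
the exponential moment of `∑ i ∈ I \ {j}, |⟨φᵢ, φⱼ⟩|²` is dominated by that of independent
sampling, and a union bound runs over `j ∈ I`. Outside this bad event, the Gram deviation is
decoupled. A uniformly random splitting of `I` into `T` and `I \ T` turns the quadratic form of
`Φᵀ Φ - 1` into a bilinear form between the two blocks, and the `2q`-th power of its norm is at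
most the trace of the `q`-th power of `∑ j ∈ I \ T, vⱼ vⱼᵀ`, where `vⱼ` is the `j`-th column of
`Φᵀ Φ - 1` restricted to `T`; there the bound on the correlations says that the `vⱼ` are short.

For vectors `vᵢ` with `|vᵢ|² ≤ R` and `∑ vᵢ vᵢᵀ ≤ λ`, the mean of `tr (∑ i ∈ I, vᵢ vᵢᵀ) ^ q` over
random sets `I` is bounded by a recursion on `q`. Write the power as a sum over `i ∈ I` of moments
`vᵢ · (A + vᵢ vᵢᵀ) ^ (q - 1) vᵢ`, where `A` is the sum over `I \ {i}`. Replacing `vᵢ vᵢᵀ` by `R`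
only increases them, and then `I \ {i}` can be averaged independently of `i`, which leaves traces
of lower powers of `A`. This estimate is used twice: for the columns of a block given `T`, and for
the rows in `T`, whose trace moment supplies the spectral bound `λ` of the block. Markov's
inequality with `q ≈ 6 log (1 / ε)` concludes.
-/

namespace StRIP

open Finset Matrix
open scoped BigOperators

lemma sum_mul_sum_le_of_monovary {ι : Type*} {s : Finset ι} {w f g : ι → ℝ}
    (hw : ∀ i ∈ s, 0 ≤ w i) (hfg : Monovary f g) :
    (∑ i ∈ s, f i * w i) * (∑ i ∈ s, g i * w i) ≤ (∑ i ∈ s, w i) * ∑ i ∈ s, f i * g i * w i := by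
  have nonneg : 0 ≤ ∑ i ∈ s, ∑ j ∈ s, w i * w j * ((f j - f i) * (g j - g i)) :=
    sum_nonneg fun i hi => sum_nonneg fun j hj =>
      mul_nonneg (mul_nonneg (hw i hi) (hw j hj)) (hfg.sub_mul_sub_nonneg i j)
  have expand : ∑ i ∈ s, ∑ j ∈ s, w i * w j * ((f j - f i) * (g j - g i))
      = 2 * ((∑ i ∈ s, w i) * ∑ i ∈ s, f i * g i * w i)
        - 2 * ((∑ i ∈ s, f i * w i) * ∑ i ∈ s, g i * w i) := by
    have term : ∀ i j, w i * w j * ((f j - f i) * (g j - g i))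
        = (f i * g i * w i) * w j + w i * (f j * g j * w j)
          - (f i * w i) * (g j * w j) - (g i * w i) * (f j * w j) := fun i j => by ring
    simp only [term, sum_sub_distrib, sum_add_distrib, ← sum_mul_sum]
    ring
  linarith

section SpectralMoments

variable {n : Type*} [Fintype n]

lemma dotProduct_self_nonneg (x : n → ℝ) : 0 ≤ x ⬝ᵥ x :=
  sum_nonneg fun _ _ => mul_self_nonneg _

variable [DecidableEq n] {A : Matrix n n ℝ}

lemma pow_mulVec_eigenvectorBasis (hA : A.IsHermitian) (k : ℕ) (s : n) :
    A ^ k *ᵥ ⇑(hA.eigenvectorBasis s) = hA.eigenvalues s ^ k • ⇑(hA.eigenvectorBasis s) := by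
  induction k with
  | zero => simp
  | succ k ih =>
    rw [pow_succ, ← mulVec_mulVec, hA.mulVec_eigenvectorBasis, mulVec_smul, ih, smul_smul,
      pow_succ']

lemma eigenvectorBasis_dotProduct_self (hA : A.IsHermitian) (s : n) :
    ⇑(hA.eigenvectorBasis s) ⬝ᵥ ⇑(hA.eigenvectorBasis s) = 1 := by
  have := hA.eigenvectorBasis.inner_eq_one s
  rwa [EuclideanSpace.inner_eq_star_dotProduct, star_trivial] at this

/-- The mass at the `s`-th eigenvalue of the spectral measure of `A` at the vector `x`: the moments
`x · Aᵏ x` are the moments of this measure. -/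
noncomputable def spectralWeight (hA : A.IsHermitian) (x : n → ℝ) (s : n) : ℝ :=
  (⇑(hA.eigenvectorBasis s) ⬝ᵥ x) ^ 2

lemma spectralWeight_nonneg (hA : A.IsHermitian) (x : n → ℝ) (s : n) :
    0 ≤ spectralWeight hA x s :=
  sq_nonneg _

lemma dotProduct_pow_mulVec (hA : A.IsHermitian) (x : n → ℝ) (k : ℕ) :
    x ⬝ᵥ (A ^ k *ᵥ x) = ∑ s, hA.eigenvalues s ^ k * spectralWeight hA x s := by
  have hsymm : (A ^ k)ᵀ = A ^ k := by
    simpa only [IsHermitian, conjTranspose_eq_transpose_of_trivial] using hA.pow k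
  have hcoord : ∀ s, ⇑(hA.eigenvectorBasis s) ⬝ᵥ (A ^ k *ᵥ x)
      = hA.eigenvalues s ^ k * (⇑(hA.eigenvectorBasis s) ⬝ᵥ x) := fun s => by
    rw [dotProduct_mulVec, ← mulVec_transpose, hsymm, pow_mulVec_eigenvectorBasis, smul_dotProduct,
      smul_eq_mul]
  have := hA.eigenvectorBasis.sum_inner_mul_inner (WithLp.toLp 2 (A ^ k *ᵥ x)) (WithLp.toLp 2 x)
  simp only [EuclideanSpace.inner_eq_star_dotProduct, star_trivial] at this
  rw [← this]
  refine sum_congr rfl fun s _ => ?_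
  rw [hcoord, dotProduct_comm x, spectralWeight]
  ring

lemma sum_spectralWeight (hA : A.IsHermitian) (x : n → ℝ) :
    ∑ s, spectralWeight hA x s = x ⬝ᵥ x := by
  simpa using (dotProduct_pow_mulVec hA x 0).symm

lemma trace_pow_eq_sum_eigenvalues_pow (hA : A.IsHermitian) (k : ℕ) :
    (A ^ k).trace = ∑ s, hA.eigenvalues s ^ k := by
  have hdiag : ∀ j, (A ^ k) j j
      = ∑ s, hA.eigenvalues s ^ k * (hA.eigenvectorBasis s j * hA.eigenvectorBasis s j) :=
    fun j => by
      simpa [spectralWeight, sq] using dotProduct_pow_mulVec hA (Pi.single j 1) k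
  simp only [trace, diag_apply, hdiag]
  rw [sum_comm]
  refine sum_congr rfl fun s _ => ?_
  rw [← mul_sum]
  exact (congrArg _ (eigenvectorBasis_dotProduct_self hA s)).trans (mul_one _)

lemma dotProduct_pow_mulVec_nonneg (hA : A.PosSemidef) (x : n → ℝ) (k : ℕ) :
    0 ≤ x ⬝ᵥ (A ^ k *ᵥ x) := by
  simpa using (hA.pow k).dotProduct_mulVec_nonneg x

lemma moment_mul_moment_le (hA : A.PosSemidef) (x : n → ℝ) (i j : ℕ) :
    (x ⬝ᵥ (A ^ i *ᵥ x)) * (x ⬝ᵥ (A ^ j *ᵥ x)) ≤ (x ⬝ᵥ x) * (x ⬝ᵥ (A ^ (i + j) *ᵥ x)) := by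
  have hmono : Monovary (fun s => hA.1.eigenvalues s ^ i) fun s => hA.1.eigenvalues s ^ j :=
    fun s t hst => pow_le_pow_left₀ (hA.eigenvalues_nonneg s)
      (le_of_lt (lt_of_pow_lt_pow_left₀ j (hA.eigenvalues_nonneg t) hst)) i
  rw [← sum_spectralWeight hA.1 x]
  simp only [dotProduct_pow_mulVec hA.1, pow_add (hA.1.eigenvalues _)]
  exact sum_mul_sum_le_of_monovary (fun s _ => spectralWeight_nonneg hA.1 x s) hmono

section RankOneUpdate

variable {v : n → ℝ} {R : ℝ}

lemma dotProduct_pow_mul_add_smul_one_pow_succ (A : Matrix n n ℝ) (v : n → ℝ) (R : ℝ) (p k : ℕ) :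
    v ⬝ᵥ ((A ^ p * (A + R • 1) ^ (k + 1)) *ᵥ v)
      = v ⬝ᵥ ((A ^ (p + 1) * (A + R • 1) ^ k) *ᵥ v)
        + R * (v ⬝ᵥ ((A ^ p * (A + R • 1) ^ k) *ᵥ v)) := by
  rw [pow_succ' (A + R • 1), ← Matrix.mul_assoc, Matrix.mul_add, ← pow_succ, Matrix.add_mul,
    add_mulVec, dotProduct_add]
  simp [smul_mulVec]

lemma dotProduct_pow_mul_add_vecMulVec_pow_succ (A : Matrix n n ℝ) (v : n → ℝ) (p k : ℕ) :
    v ⬝ᵥ ((A ^ p * (A + vecMulVec v v) ^ (k + 1)) *ᵥ v)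
      = v ⬝ᵥ ((A ^ (p + 1) * (A + vecMulVec v v) ^ k) *ᵥ v)
        + (v ⬝ᵥ (A ^ p *ᵥ v)) * (v ⬝ᵥ ((A + vecMulVec v v) ^ k *ᵥ v)) := by
  rw [pow_succ' (A + vecMulVec v v), ← Matrix.mul_assoc, Matrix.mul_add, ← pow_succ,
    Matrix.add_mul, add_mulVec, dotProduct_add, mul_vecMulVec, vecMulVec_mul, vecMulVec_mulVec,
    ← dotProduct_mulVec]
  simp [mul_comm]

lemma moment_mul_shifted_moment_le (hA : A.PosSemidef) (hv : v ⬝ᵥ v ≤ R) (k i j : ℕ) :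
    (v ⬝ᵥ (A ^ i *ᵥ v)) * (v ⬝ᵥ ((A ^ j * (A + R • 1) ^ k) *ᵥ v))
      ≤ R * (v ⬝ᵥ ((A ^ (i + j) * (A + R • 1) ^ k) *ᵥ v)) := by
  induction k generalizing j with
  | zero =>
    simpa using (moment_mul_moment_le hA v i j).trans
      (mul_le_mul_of_nonneg_right hv (dotProduct_pow_mulVec_nonneg hA v _))
  | succ k ih =>
    rw [dotProduct_pow_mul_add_smul_one_pow_succ, dotProduct_pow_mul_add_smul_one_pow_succ,
      mul_add, mul_add, mul_left_comm _ R]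
    exact add_le_add (ih (j + 1))
      (mul_le_mul_of_nonneg_left (ih j) ((dotProduct_self_nonneg v).trans hv))

lemma moment_add_vecMulVec_le (hA : A.PosSemidef) (hv : v ⬝ᵥ v ≤ R) (k : ℕ) :
    v ⬝ᵥ ((A + vecMulVec v v) ^ k *ᵥ v) ≤ v ⬝ᵥ ((A + R • 1) ^ k *ᵥ v) := by
  suffices h : ∀ p, v ⬝ᵥ ((A ^ p * (A + vecMulVec v v) ^ k) *ᵥ v)
      ≤ v ⬝ᵥ ((A ^ p * (A + R • 1) ^ k) *ᵥ v) by simpa using h 0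
  induction k with
  | zero => intro p; simp
  | succ k ih =>
    intro p
    rw [dotProduct_pow_mul_add_vecMulVec_pow_succ, dotProduct_pow_mul_add_smul_one_pow_succ]
    refine add_le_add (ih (p + 1)) ?_
    calc (v ⬝ᵥ (A ^ p *ᵥ v)) * (v ⬝ᵥ ((A + vecMulVec v v) ^ k *ᵥ v))
        ≤ (v ⬝ᵥ (A ^ p *ᵥ v)) * (v ⬝ᵥ ((A + R • 1) ^ k *ᵥ v)) :=
          mul_le_mul_of_nonneg_left (by simpa using ih 0) (dotProduct_pow_mulVec_nonneg hA v p)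
      _ ≤ R * (v ⬝ᵥ ((A ^ p * (A + R • 1) ^ k) *ᵥ v)) := by
          simpa using moment_mul_shifted_moment_le hA hv k p 0

end RankOneUpdate

lemma dotProduct_mulVec_pow_le_trace (hA : A.PosSemidef) (x : n → ℝ) {q : ℕ} (hq : q ≠ 0) :
    (x ⬝ᵥ (A *ᵥ x)) ^ q ≤ (x ⬝ᵥ x) ^ q * (A ^ q).trace := by
  have hquad : x ⬝ᵥ (A *ᵥ x) = ∑ s, hA.1.eigenvalues s * spectralWeight hA.1 x s := by
    simpa using dotProduct_pow_mulVec hA.1 x 1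
  rcases isEmpty_or_nonempty n with hn | hn
  · simp [hq]
  obtain ⟨s₀, hs₀⟩ := Finite.exists_max hA.1.eigenvalues
  have hmax : x ⬝ᵥ (A *ᵥ x) ≤ hA.1.eigenvalues s₀ * (x ⬝ᵥ x) := by
    rw [hquad, ← sum_spectralWeight hA.1, mul_sum]
    exact sum_le_sum fun s _ =>
      mul_le_mul_of_nonneg_right (hs₀ s) (spectralWeight_nonneg hA.1 x s)
  have htrace : hA.1.eigenvalues s₀ ^ q ≤ (A ^ q).trace := by
    rw [trace_pow_eq_sum_eigenvalues_pow hA.1]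
    exact single_le_sum (fun s _ => pow_nonneg (hA.eigenvalues_nonneg s) q) (mem_univ s₀)
  calc (x ⬝ᵥ (A *ᵥ x)) ^ q ≤ (hA.1.eigenvalues s₀ * (x ⬝ᵥ x)) ^ q :=
        pow_le_pow_left₀ (by simpa using hA.dotProduct_mulVec_nonneg x) hmax q
    _ = (x ⬝ᵥ x) ^ q * hA.1.eigenvalues s₀ ^ q := by rw [mul_pow, mul_comm]
    _ ≤ (x ⬝ᵥ x) ^ q * (A ^ q).trace :=
        mul_le_mul_of_nonneg_left htrace (pow_nonneg (dotProduct_self_nonneg x) q)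

lemma sum_moment_le_trace {ι : Type*} (hA : A.PosSemidef) (s : Finset ι) (v : ι → n → ℝ) {lam : ℝ}
    (hlam : ∀ x, ∑ i ∈ s, (v i ⬝ᵥ x) ^ 2 ≤ lam * (x ⬝ᵥ x)) (k : ℕ) :
    ∑ i ∈ s, v i ⬝ᵥ (A ^ k *ᵥ v i) ≤ lam * (A ^ k).trace := by
  simp only [dotProduct_pow_mulVec hA.1, trace_pow_eq_sum_eigenvalues_pow hA.1]
  rw [sum_comm, mul_sum]
  refine sum_le_sum fun t _ => ?_
  have hweight : ∑ i ∈ s, spectralWeight hA.1 (v i) t ≤ lam := by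
    have := hlam (hA.1.eigenvectorBasis t)
    rw [eigenvectorBasis_dotProduct_self, mul_one] at this
    simpa only [spectralWeight, dotProduct_comm (hA.1.eigenvectorBasis t).ofLp] using this
  rw [← mul_sum, mul_comm lam]
  exact mul_le_mul_of_nonneg_left hweight (pow_nonneg (hA.eigenvalues_nonneg t) k)

end SpectralMoments

section SubsetAverages

variable {ι : Type*} [DecidableEq ι]

lemma sum_powersetCard_succ_sum_erase {M : Type*} [AddCommMonoid M] (s : Finset ι) (k : ℕ)
    (F : ι → Finset ι → M) :
    ∑ I ∈ s.powersetCard (k + 1), ∑ i ∈ I, F i (I.erase i)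
      = ∑ J ∈ s.powersetCard k, ∑ i ∈ s \ J, F i J := by
  rw [sum_sigma', sum_sigma']
  refine sum_bij' (fun p _ => ⟨p.1.erase p.2, p.2⟩) (fun p _ => ⟨insert p.2 p.1, p.2⟩)
    ?_ ?_ ?_ ?_ ?_
  · rintro ⟨I, i⟩ h
    simp only [mem_sigma, mem_powersetCard, mem_sdiff] at h ⊢
    obtain ⟨⟨hI, hcard⟩, hi⟩ := h
    exact ⟨⟨(erase_subset _ _).trans hI, by rw [card_erase_of_mem hi, hcard]; rfl⟩, hI hi, by simp⟩
  · rintro ⟨J, i⟩ h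
    simp only [mem_sigma, mem_powersetCard, mem_sdiff] at h ⊢
    obtain ⟨⟨hJ, hcard⟩, hi, hiJ⟩ := h
    exact ⟨⟨insert_subset hi hJ, by rw [card_insert_of_notMem hiJ, hcard]⟩, mem_insert_self _ _⟩
  · rintro ⟨I, i⟩ h
    simp [insert_erase (mem_sigma.1 h).2]
  · rintro ⟨J, i⟩ h
    simp [erase_insert (mem_sdiff.1 (mem_sigma.1 h).2).2]
  · rintro ⟨I, i⟩ _
    rfl

lemma card_sub_mul_expect_sum_erase (s : Finset ι) (k : ℕ) (F : ι → Finset ι → ℝ) :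
    ((#s : ℝ) - k) * 𝔼 I ∈ s.powersetCard (k + 1), ∑ i ∈ I, F i (I.erase i)
      = (k + 1) * 𝔼 J ∈ s.powersetCard k, ∑ i ∈ s \ J, F i J := by
  rcases lt_or_ge #s k with hk | hk
  · rw [powersetCard_eq_empty.2 hk, powersetCard_eq_empty.2 (hk.trans (lt_add_one k))]
    simp
  rcases hk.eq_or_lt with rfl | hk
  · rw [powersetCard_eq_empty.2 (lt_add_one _), powersetCard_self]
    simp
  have hchoose : ((#s).choose (k + 1) : ℝ) * (k + 1) = (#s).choose k * ((#s : ℝ) - k) := by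
    have := congrArg (Nat.cast (R := ℝ)) (Nat.choose_succ_right_eq (#s) k)
    push_cast [Nat.cast_sub hk.le] at this
    exact this
  have h0 : ((#s).choose k : ℝ) ≠ 0 := by exact_mod_cast (Nat.choose_pos hk.le).ne'
  have h1 : ((#s).choose (k + 1) : ℝ) ≠ 0 := by exact_mod_cast (Nat.choose_pos hk).ne'
  rw [expect_eq_sum_div_card, expect_eq_sum_div_card, sum_powersetCard_succ_sum_erase,
    card_powersetCard, card_powersetCard, mul_div_assoc', mul_div_assoc', div_eq_div_iff h1 h0]
  linear_combination -(∑ J ∈ s.powersetCard k, ∑ i ∈ s \ J, F i J) * hchoose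

lemma expect_sum_erase_le {s : Finset ι} {k : ℕ} {ρ : ℝ} {F : ι → Finset ι → ℝ} (hρ : 0 ≤ ρ)
    (hkρ : (k : ℝ) + 1 ≤ ρ * ((#s : ℝ) - k)) (hF : ∀ i ∈ s, ∀ J ∈ s.powersetCard k, 0 ≤ F i J) :
    𝔼 I ∈ s.powersetCard (k + 1), ∑ i ∈ I, F i (I.erase i)
      ≤ ρ * 𝔼 J ∈ s.powersetCard k, ∑ i ∈ s, F i J := by
  have hpos : 0 < (#s : ℝ) - k := pos_of_mul_pos_right (by linarith [k.cast_nonneg (α := ℝ)]) hρ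
  have hsdiff : 𝔼 J ∈ s.powersetCard k, ∑ i ∈ s \ J, F i J
      ≤ 𝔼 J ∈ s.powersetCard k, ∑ i ∈ s, F i J :=
    expect_le_expect fun J hJ =>
      sum_le_sum_of_subset_of_nonneg sdiff_subset fun i hi _ => hF i hi J hJ
  have hnonneg : 0 ≤ 𝔼 J ∈ s.powersetCard k, ∑ i ∈ s, F i J :=
    expect_nonneg fun J hJ => sum_nonneg fun i hi => hF i hi J hJ
  refine le_of_mul_le_mul_left ?_ hpos
  calc ((#s : ℝ) - k) * 𝔼 I ∈ s.powersetCard (k + 1), ∑ i ∈ I, F i (I.erase i)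
      = (k + 1) * 𝔼 J ∈ s.powersetCard k, ∑ i ∈ s \ J, F i J :=
        card_sub_mul_expect_sum_erase s k F
    _ ≤ (k + 1) * 𝔼 J ∈ s.powersetCard k, ∑ i ∈ s, F i J := by gcongr
    _ ≤ (ρ * ((#s : ℝ) - k)) * 𝔼 J ∈ s.powersetCard k, ∑ i ∈ s, F i J := by gcongr
    _ = ((#s : ℝ) - k) * (ρ * 𝔼 J ∈ s.powersetCard k, ∑ i ∈ s, F i J) := by ring

lemma card_mul_expect_sum_erase (s : Finset ι) (k : ℕ) (F : ι → Finset ι → ℝ) :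
    (#s : ℝ) * 𝔼 I ∈ s.powersetCard (k + 1), ∑ i ∈ I, F i (I.erase i)
      = (k + 1) * ∑ i ∈ s, 𝔼 J ∈ (s.erase i).powersetCard k, F i J := by
  rcases lt_or_ge k #s with hk | hk
  · obtain ⟨n, hn⟩ := Nat.exists_eq_add_of_lt hk
    have hcard : ∀ i ∈ s, (#(s.erase i)).choose k = (k + n).choose k := fun i hi => by
      rw [card_erase_of_mem hi, hn, Nat.add_sub_cancel]
    have hchoose : ((k + n + 1 : ℕ) : ℝ) * (k + n).choose k
        = (k + n + 1).choose (k + 1) * (k + 1 : ℕ) := by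
      exact_mod_cast Nat.add_one_mul_choose_eq (k + n) k
    have h0 : ((k + n).choose k : ℝ) ≠ 0 := by
      exact_mod_cast (Nat.choose_pos (Nat.le_add_right k n)).ne'
    have h1 : ((k + n + 1).choose (k + 1) : ℝ) ≠ 0 := by
      exact_mod_cast (Nat.choose_pos (by lia)).ne'
    have hexpect : ∑ i ∈ s, 𝔼 J ∈ (s.erase i).powersetCard k, F i J
        = (∑ i ∈ s, ∑ J ∈ (s.erase i).powersetCard k, F i J) / (k + n).choose k := by
      rw [sum_div]
      refine sum_congr rfl fun i hi => ?_
      rw [expect_eq_sum_div_card, card_powersetCard, hcard i hi]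
    have hcomm : ∑ J ∈ s.powersetCard k, ∑ i ∈ s \ J, F i J
        = ∑ i ∈ s, ∑ J ∈ (s.erase i).powersetCard k, F i J :=
      sum_comm' fun J i => by simp only [mem_powersetCard, mem_sdiff, subset_erase]; tauto
    rw [hexpect, expect_eq_sum_div_card, sum_powersetCard_succ_sum_erase, hcomm,
      card_powersetCard, hn, mul_div_assoc', mul_div_assoc', div_eq_div_iff h1 h0]
    push_cast at hchoose ⊢
    linear_combination (∑ i ∈ s, ∑ J ∈ (s.erase i).powersetCard k, F i J) * hchoose
  · rw [powersetCard_eq_empty.2 (Nat.lt_succ_of_le hk), expect_empty, mul_zero, eq_comm]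
    refine mul_eq_zero_of_right _ (sum_eq_zero fun i hi => ?_)
    rw [powersetCard_eq_empty.2 ((card_erase_lt_of_mem hi).trans_le hk), expect_empty]

end SubsetAverages

section SubsetProb

variable {ι : Type*} {s : Finset ι} {k : ℕ} {E F : Set (Finset ι)}

/-- The probability of the event `E` for a uniformly random `k`-subset of `s`; it is `0` if `s` has
no `k`-subset. -/
noncomputable def subsetProb (s : Finset ι) (k : ℕ) (E : Set (Finset ι)) : ℝ :=
  𝔼 I ∈ s.powersetCard k, E.indicator 1 I

lemma probSubset_eq_subsetProb (N k : ℕ) (E : Set (Finset (Fin N))) :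
    probSubset N k E = subsetProb univ k E := by
  classical
  rw [probSubset, subsetProb, expect_eq_sum_div_card, card_filter]
  push_cast
  simp only [Set.indicator_apply, Pi.one_apply]

lemma subsetProb_union_le : subsetProb s k (E ∪ F) ≤ subsetProb s k E + subsetProb s k F := by
  rw [subsetProb, subsetProb, subsetProb, ← expect_add_distrib]
  refine expect_le_expect fun I _ => ?_
  by_cases hE : I ∈ E <;> by_cases hF : I ∈ F <;> simp [hE, hF]

lemma subsetProb_mono (h : ∀ I ∈ s.powersetCard k, I ∈ E → I ∈ F) :
    subsetProb s k E ≤ subsetProb s k F := by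
  classical
  refine expect_le_expect fun I hI => ?_
  by_cases hE : I ∈ E
  · rw [Set.indicator_of_mem hE, Set.indicator_of_mem (h I hI hE)]
  · rw [Set.indicator_of_notMem hE]
    exact Set.indicator_nonneg (fun _ _ => zero_le_one) I

lemma subsetProb_mul_le_expect {f : Finset ι → ℝ} {x : ℝ} (hf : ∀ I ∈ s.powersetCard k, 0 ≤ f I)
    (hx : ∀ I ∈ s.powersetCard k, I ∈ E → x ≤ f I) :
    subsetProb s k E * x ≤ 𝔼 I ∈ s.powersetCard k, f I := by
  rw [subsetProb, expect_mul]
  refine expect_le_expect fun I hI => ?_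
  by_cases hE : I ∈ E
  · simpa [hE] using hx I hI hE
  · simpa [hE] using hf I hI

lemma subsetProb_exists_mem_erase_le [DecidableEq ι] {G : ι → Set (Finset ι)} {B : ℝ} (hB : 0 ≤ B)
    (hG : ∀ j ∈ s, subsetProb (s.erase j) k (G j) ≤ B) :
    subsetProb s (k + 1) {I | ∃ j ∈ I, I.erase j ∈ G j} ≤ (k + 1) * B := by
  rcases s.eq_empty_or_nonempty with rfl | hs
  · rw [subsetProb, powersetCard_eq_empty.2 (by simp), expect_empty]
    positivity
  have hunion : subsetProb s (k + 1) {I | ∃ j ∈ I, I.erase j ∈ G j}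
      ≤ 𝔼 I ∈ s.powersetCard (k + 1), ∑ j ∈ I, (G j).indicator (1 : Finset ι → ℝ) (I.erase j) := by
    have hnonneg : ∀ (I : Finset ι) j, 0 ≤ (G j).indicator (1 : Finset ι → ℝ) (I.erase j) :=
      fun I j => Set.indicator_nonneg (fun _ _ => zero_le_one) _
    rw [← mul_one (subsetProb _ _ _)]
    refine subsetProb_mul_le_expect (fun I _ => sum_nonneg fun j _ => hnonneg I j) ?_
    rintro I - ⟨j, hj, hGj⟩
    exact (Set.indicator_of_mem hGj 1).ge.trans
      (single_le_sum (f := fun j => (G j).indicator 1 (I.erase j)) (fun j _ => hnonneg I j) hj)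
  have hcard : (0 : ℝ) < #s := by exact_mod_cast hs.card_pos
  refine hunion.trans (le_of_mul_le_mul_left ?_ hcard)
  rw [card_mul_expect_sum_erase s k fun j J => (G j).indicator 1 J]
  calc ((k : ℝ) + 1) * ∑ j ∈ s, subsetProb (s.erase j) k (G j) ≤ (k + 1) * (#s * B) := by
        gcongr
        simpa using sum_le_card_nsmul s _ B hG
    _ = #s * ((k + 1) * B) := by ring

end SubsetProb

lemma two_mul_pow_add_one_add_pow_le {r : ℝ} {p : ℕ} (hr : 0 ≤ r) (hpr : (p + 1) * r ≤ 1) :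
    2 * r ^ p + (1 + r) ^ p ≤ 3 := by
  rcases p.eq_zero_or_pos with rfl | hp
  · norm_num
  have hp1 : (1 : ℝ) ≤ p := by exact_mod_cast hp
  have hpow : r ^ p ≤ r := pow_le_of_le_one hr (by nlinarith) hp.ne'
  have hexp : (1 + r) * (1 + r) ^ p ≤ Real.exp 1 := by
    calc (1 + r) * (1 + r) ^ p = (r + 1) ^ (p + 1) := by ring
      _ ≤ Real.exp r ^ (p + 1) := by gcongr; exact Real.add_one_le_exp r
      _ = Real.exp ((p + 1) * r) := by rw [← Real.exp_nat_mul]; push_cast; rfl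
      _ ≤ Real.exp 1 := Real.exp_le_exp.2 hpr
  have hle : (1 + r) * (1 + r) ^ p ≤ (1 + r) * (3 - 2 * r) := by
    nlinarith [Real.exp_one_lt_d9]
  linarith [le_of_mul_le_mul_left hle (by linarith)]

lemma two_mul_pow_add_add_pow_le {R K : ℝ} {p : ℕ} (hR : 0 ≤ R) (hRK : (p + 1) * R ≤ K) :
    2 * R ^ p + (K + R) ^ p ≤ 3 * K ^ p := by
  rcases hR.eq_or_lt with rfl | hR0
  · have : (0 : ℝ) ^ p ≤ K ^ p := pow_le_pow_left₀ le_rfl (by simpa using hRK) p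
    rw [add_zero]
    linarith
  have hK : 0 < K := lt_of_lt_of_le (by positivity) hRK
  have hscaled := two_mul_pow_add_one_add_pow_le (r := R / K) (p := p) (by positivity)
    (by rwa [mul_div_assoc', div_le_one hK])
  calc 2 * R ^ p + (K + R) ^ p = K ^ p * (2 * (R / K) ^ p + (1 + R / K) ^ p) := by
        rw [mul_add, mul_left_comm, ← mul_pow, ← mul_pow, mul_add, mul_one,
          mul_div_cancel₀ _ hK.ne']
    _ ≤ 3 * K ^ p := by rw [mul_comm]; gcongr

lemma max_pow_le_add_pow {x y : ℝ} (hx : 0 ≤ x) (hy : 0 ≤ y) (q : ℕ) :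
    max x y ^ q ≤ x ^ q + y ^ q := by
  rcases max_cases x y with ⟨h, -⟩ | ⟨h, -⟩ <;> rw [h]
  · exact le_add_of_nonneg_right (pow_nonneg hy q)
  · exact le_add_of_nonneg_left (pow_nonneg hx q)

section RankOneSums

variable {ι n : Type*}

/-- The sum of the rank-one matrices `vᵢ vᵢᵀ` over `i ∈ J`: for columns `vᵢ`, the Gram-type matrix
whose trace moments control the spectral norm of the submatrix with columns in `J`. -/
def rankOneSum (v : ι → n → ℝ) (J : Finset ι) : Matrix n n ℝ :=
  ∑ i ∈ J, vecMulVec (v i) (v i)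

lemma rankOneSum_posSemidef [Finite n] (v : ι → n → ℝ) (J : Finset ι) :
    (rankOneSum v J).PosSemidef :=
  posSemidef_sum _ fun i _ => by simpa using posSemidef_vecMulVec_self_star (v i)

variable [Fintype n]

lemma dotProduct_rankOneSum_mulVec (v : ι → n → ℝ) (J : Finset ι) (x : n → ℝ) :
    x ⬝ᵥ (rankOneSum v J *ᵥ x) = ∑ i ∈ J, (v i ⬝ᵥ x) ^ 2 := by
  rw [rankOneSum, sum_mulVec, dotProduct_sum]
  refine sum_congr rfl fun i _ => ?_
  rw [vecMulVec_mulVec, op_smul_eq_smul, dotProduct_smul, smul_eq_mul, dotProduct_comm x, sq]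

variable [DecidableEq n]

lemma trace_rankOneSum_pow_succ (v : ι → n → ℝ) (J : Finset ι) (k : ℕ) :
    (rankOneSum v J ^ (k + 1)).trace = ∑ i ∈ J, v i ⬝ᵥ (rankOneSum v J ^ k *ᵥ v i) := by
  conv_lhs => rw [pow_succ, rankOneSum, Matrix.mul_sum, trace_sum, ← rankOneSum]
  exact sum_congr rfl fun i _ => by rw [mul_vecMulVec, trace_vecMulVec, dotProduct_comm]

lemma dotProduct_add_smul_one_pow_mulVec (A : Matrix n n ℝ) (x : n → ℝ) (R : ℝ) (p : ℕ) :
    x ⬝ᵥ ((A + R • 1) ^ p *ᵥ x)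
      = ∑ j ∈ range (p + 1), (R ^ (p - j) * p.choose j) * (x ⬝ᵥ (A ^ j *ᵥ x)) := by
  have hcomm : Commute A (R • (1 : Matrix n n ℝ)) := (Commute.one_right A).smul_right R
  rw [hcomm.add_pow, sum_mulVec, dotProduct_sum]
  refine sum_congr rfl fun j _ => ?_
  rw [smul_pow, one_pow, mul_smul_comm, mul_one, ← nsmul_eq_mul', smul_mulVec, smul_mulVec,
    dotProduct_smul, dotProduct_smul, nsmul_eq_mul, smul_eq_mul]
  ring

lemma sum_moment_add_smul_one_le {A : Matrix n n ℝ} (hA : A.PosSemidef) (s : Finset ι)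
    (v : ι → n → ℝ) {R lam : ℝ} (hR : 0 ≤ R)
    (hlam : ∀ x, ∑ i ∈ s, (v i ⬝ᵥ x) ^ 2 ≤ lam * (x ⬝ᵥ x)) (p : ℕ) :
    ∑ i ∈ s, v i ⬝ᵥ ((A + R • 1) ^ p *ᵥ v i) ≤ R ^ p * ∑ i ∈ s, v i ⬝ᵥ v i
      + lam * ∑ j ∈ range p, R ^ (p - (j + 1)) * p.choose (j + 1) * (A ^ (j + 1)).trace := by
  simp only [dotProduct_add_smul_one_pow_mulVec]
  rw [sum_comm, sum_range_succ', add_comm, mul_sum _ _ lam]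
  refine add_le_add (by simp [mul_sum]) (sum_le_sum fun j _ => ?_)
  rw [← mul_sum, mul_left_comm lam]
  gcongr
  exact sum_moment_le_trace hA s v hlam (j + 1)

lemma trace_rankOneSum_pow_succ_le [DecidableEq ι] (v : ι → n → ℝ) (I : Finset ι) {R : ℝ}
    (hv : ∀ i ∈ I, v i ⬝ᵥ v i ≤ R) (p : ℕ) :
    (rankOneSum v I ^ (p + 1)).trace
      ≤ ∑ i ∈ I, v i ⬝ᵥ ((rankOneSum v (I.erase i) + R • 1) ^ p *ᵥ v i) := by
  rw [trace_rankOneSum_pow_succ]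
  refine sum_le_sum fun i hi => ?_
  rw [rankOneSum, ← sum_erase_add _ _ hi, ← rankOneSum]
  exact moment_add_vecMulVec_le (rankOneSum_posSemidef _ _) (hv i hi) p

lemma expect_trace_rankOneSum_pow_succ_le {s : Finset ι} {v : ι → n → ℝ} {R lam ρ : ℝ} {k : ℕ}
    (hR : 0 ≤ R) (hρ : 0 ≤ ρ) (hv : ∀ i ∈ s, v i ⬝ᵥ v i ≤ R)
    (hlam : ∀ x, ∑ i ∈ s, (v i ⬝ᵥ x) ^ 2 ≤ lam * (x ⬝ᵥ x))
    (hkρ : (k : ℝ) + 1 ≤ ρ * ((#s : ℝ) - k)) (p : ℕ) :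
    𝔼 I ∈ s.powersetCard (k + 1), (rankOneSum v I ^ (p + 1)).trace
      ≤ ρ * (R ^ p * ∑ i ∈ s, v i ⬝ᵥ v i + lam * ∑ j ∈ range p, R ^ (p - (j + 1))
        * p.choose (j + 1) * 𝔼 J ∈ s.powersetCard k, (rankOneSum v J ^ (j + 1)).trace) := by
  classical
  have hks : k ≤ #s := by
    have : 0 < (#s : ℝ) - k := pos_of_mul_pos_right (by linarith [k.cast_nonneg (α := ℝ)]) hρ
    exact_mod_cast (sub_pos.1 this).le
  calc 𝔼 I ∈ s.powersetCard (k + 1), (rankOneSum v I ^ (p + 1)).trace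
      ≤ 𝔼 I ∈ s.powersetCard (k + 1),
          ∑ i ∈ I, v i ⬝ᵥ ((rankOneSum v (I.erase i) + R • 1) ^ p *ᵥ v i) :=
        expect_le_expect fun I hI => trace_rankOneSum_pow_succ_le v I
          (fun i hi => hv i ((mem_powersetCard.1 hI).1 hi)) p
    _ ≤ ρ * 𝔼 J ∈ s.powersetCard k,
          ∑ i ∈ s, v i ⬝ᵥ ((rankOneSum v J + R • 1) ^ p *ᵥ v i) :=
        expect_sum_erase_le (F := fun i J => v i ⬝ᵥ ((rankOneSum v J + R • 1) ^ p *ᵥ v i)) hρ hkρ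
          fun i _ J _ => dotProduct_pow_mulVec_nonneg
            ((rankOneSum_posSemidef v J).add (PosSemidef.one.smul hR)) _ _
    _ ≤ ρ * 𝔼 J ∈ s.powersetCard k, (R ^ p * ∑ i ∈ s, v i ⬝ᵥ v i + lam * ∑ j ∈ range p,
          R ^ (p - (j + 1)) * p.choose (j + 1) * (rankOneSum v J ^ (j + 1)).trace) := by
        refine mul_le_mul_of_nonneg_left (expect_le_expect fun J _ => ?_) hρ
        exact sum_moment_add_smul_one_le (rankOneSum_posSemidef v J) s v hR hlam p
    _ = _ := by
        rw [expect_add_distrib, expect_const (powersetCard_nonempty.2 hks), ← mul_expect,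
          expect_sum_comm]
        simp only [mul_expect]

lemma moment_recursion_le {R K lam ρ W D : ℝ} {p : ℕ} {M : ℕ → ℝ} (hR : 0 ≤ R) (hρ : 0 ≤ ρ)
    (hlam : 0 ≤ lam) (hD : 0 ≤ D) (hRK : (p + 1) * R ≤ K) (hlamK : 3 * (ρ * lam) ≤ K)
    (hWK : ρ * W ≤ D * K) (hM : ∀ j < p, M j ≤ D * K ^ (j + 1)) :
    ρ * (R ^ p * W + lam * ∑ j ∈ range p, R ^ (p - (j + 1)) * p.choose (j + 1) * M j)
      ≤ D * K ^ (p + 1) := by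
  have hK : 0 ≤ K := le_trans (by positivity) hlamK
  have hbinom : ∑ j ∈ range p, R ^ (p - (j + 1)) * p.choose (j + 1) * K ^ (j + 1)
      = (K + R) ^ p - R ^ p := by
    rw [add_pow, sum_range_succ']
    simp only [pow_zero, Nat.choose_zero_right, Nat.cast_one, one_mul, mul_one, Nat.sub_zero,
      add_sub_cancel_right]
    exact sum_congr rfl fun j _ => by ring
  have hsum : ∑ j ∈ range p, R ^ (p - (j + 1)) * p.choose (j + 1) * M j
      ≤ D * ((K + R) ^ p - R ^ p) := by
    rw [← hbinom, mul_sum]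
    refine sum_le_sum fun j hj => ?_
    rw [mul_left_comm]
    gcongr
    exact hM j (mem_range.1 hj)
  have hdiff : 0 ≤ (K + R) ^ p - R ^ p := sub_nonneg.2 (by gcongr; linarith)
  calc ρ * (R ^ p * W + lam * ∑ j ∈ range p, R ^ (p - (j + 1)) * p.choose (j + 1) * M j)
      ≤ ρ * (R ^ p * W + lam * (D * ((K + R) ^ p - R ^ p))) := by gcongr
    _ = R ^ p * (ρ * W) + ρ * lam * (D * ((K + R) ^ p - R ^ p)) := by ring
    _ ≤ R ^ p * (D * K) + K / 3 * (D * ((K + R) ^ p - R ^ p)) := by gcongr; linarith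
    _ = D * K / 3 * (2 * R ^ p + (K + R) ^ p) := by ring
    _ ≤ D * K / 3 * (3 * K ^ p) := by gcongr; exact two_mul_pow_add_add_pow_le hR hRK
    _ = D * K ^ (p + 1) := by ring

-- Removing one index of `I` and paying `R` for its rank-one term bounds the `(p + 1)`-st moment by
-- the lower ones, which makes the induction on `p` close.
lemma expect_trace_rankOneSum_pow_le {s : Finset ι} {v : ι → n → ℝ} {R lam ρ K D : ℝ} {q k : ℕ}
    (hR : 0 ≤ R) (hρ : 0 ≤ ρ) (hD : 0 ≤ D) (hv : ∀ i ∈ s, v i ⬝ᵥ v i ≤ R)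
    (hlam : ∀ x, ∑ i ∈ s, (v i ⬝ᵥ x) ^ 2 ≤ lam * (x ⬝ᵥ x)) (hlam0 : 0 ≤ lam)
    (hkρ : (k : ℝ) ≤ ρ * ((#s : ℝ) - k + 1)) (hRK : q * R ≤ K) (hlamK : 3 * (ρ * lam) ≤ K)
    (hDK : ρ * ∑ i ∈ s, v i ⬝ᵥ v i ≤ D * K) (hq : q ≠ 0) :
    𝔼 I ∈ s.powersetCard k, (rankOneSum v I ^ q).trace ≤ D * K ^ q := by
  obtain ⟨p, rfl⟩ := Nat.exists_eq_succ_of_ne_zero hq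
  induction p using Nat.strong_induction_on generalizing k with
  | _ p ih =>
    have hK : 0 ≤ K := le_trans (by positivity) hlamK
    cases k with
    | zero =>
      have : (0 : ℝ) ≤ D * K ^ (p + 1) := by positivity
      simpa [rankOneSum] using this
    | succ k =>
      push_cast at hkρ hRK
      have hkρ' : (k : ℝ) + 1 ≤ ρ * ((#s : ℝ) - k) := by linarith
      refine (expect_trace_rankOneSum_pow_succ_le hR hρ hv hlam hkρ' p).trans
        (moment_recursion_le hR hρ hlam0 hD hRK hlamK hDK fun j hj => ?_)
      refine ih j hj (k := k) (by linarith) ?_ j.succ_ne_zero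
      refine le_trans ?_ hRK
      gcongr
      exact_mod_cast Nat.succ_le_succ hj.le

lemma expect_trace_rankOneSum_pow_le_add {s : Finset ι} {v : ι → n → ℝ} {R lam ρ D : ℝ} {q k : ℕ}
    (hR : 0 ≤ R) (hρ : 0 ≤ ρ) (hD : 0 ≤ D) (hv : ∀ i ∈ s, v i ⬝ᵥ v i ≤ R)
    (hlam : ∀ x, ∑ i ∈ s, (v i ⬝ᵥ x) ^ 2 ≤ lam * (x ⬝ᵥ x)) (hlam0 : 0 ≤ lam)
    (hkρ : (k : ℝ) ≤ ρ * ((#s : ℝ) - k + 1))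
    (hDmax : ρ * ∑ i ∈ s, v i ⬝ᵥ v i ≤ D * max (q * R) (3 * (ρ * lam))) (hq : q ≠ 0) :
    𝔼 I ∈ s.powersetCard k, (rankOneSum v I ^ q).trace
      ≤ D * ((q * R) ^ q + (3 * (ρ * lam)) ^ q) := by
  refine (expect_trace_rankOneSum_pow_le hR hρ hD hv hlam hlam0 hkρ (le_max_left _ _)
    (le_max_right (q * R) _) hDmax hq).trans ?_
  gcongr
  exact max_pow_le_add_pow (by positivity) (by positivity) q

end RankOneSums

section SubsetSums

lemma choose_mul_pow_le {n k : ℕ} (hkn : k ≤ n) (t : ℕ) :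
    k.choose t * n ^ t ≤ n.choose t * k ^ t := by
  induction t with
  | zero => simp
  | succ t ih =>
    have hsub : (k - t) * n ≤ (n - t) * k := by
      rw [Nat.sub_mul, Nat.sub_mul, mul_comm n k]
      exact Nat.sub_le_sub_left (Nat.mul_le_mul_left t hkn) _
    refine Nat.le_of_mul_le_mul_right ?_ t.succ_pos
    calc k.choose (t + 1) * n ^ (t + 1) * (t + 1)
        = k.choose (t + 1) * (t + 1) * (n ^ t * n) := by ring
      _ = k.choose t * n ^ t * ((k - t) * n) := by rw [Nat.choose_succ_right_eq]; ring
      _ ≤ n.choose t * k ^ t * ((n - t) * k) := Nat.mul_le_mul ih hsub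
      _ = n.choose (t + 1) * (t + 1) * (k ^ t * k) := by rw [Nat.choose_succ_right_eq]; ring
      _ = n.choose (t + 1) * k ^ (t + 1) * (t + 1) := by ring

variable {ι : Type*} {s : Finset ι} {k : ℕ}

lemma subsetProb_superset_le {T : Finset ι} (hTs : T ⊆ s) (hks : k ≤ #s) :
    subsetProb s k {J | T ⊆ J} ≤ ((k : ℝ) / #s) ^ #T := by
  classical
  have hcard : 𝔼 J ∈ s.powersetCard k, {J | T ⊆ J}.indicator (1 : Finset ι → ℝ) J
      = #{J ∈ s.powersetCard k | T ⊆ J} / (#s).choose k := by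
    rw [expect_eq_sum_div_card, card_powersetCard, card_filter]
    push_cast
    simp only [Set.indicator_apply, Set.mem_ofPred_eq, Pi.one_apply]
  have hchoose : (0 : ℝ) < (#s).choose k := by exact_mod_cast Nat.choose_pos hks
  rw [subsetProb, hcard, div_le_iff₀ hchoose]
  rcases le_or_gt #T k with hTk | hTk
  · have hchooseT : (0 : ℝ) < (#s).choose #T := by
      exact_mod_cast Nat.choose_pos (card_le_card hTs)
    have hmul : ((#s).choose k : ℝ) * k.choose #T = (#s).choose #T * (#s - #T).choose (k - #T) := by
      exact_mod_cast Nat.choose_mul hTk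
    have hle : (k.choose #T : ℝ) ≤ (k / #s) ^ #T * (#s).choose #T := by
      rcases s.eq_empty_or_nonempty with rfl | hs
      · obtain rfl := subset_empty.1 hTs
        simp
      have : (0 : ℝ) < #s := by exact_mod_cast hs.card_pos
      rw [div_pow, div_mul_eq_mul_div, le_div_iff₀ (by positivity), mul_comm ((k : ℝ) ^ _)]
      exact_mod_cast choose_mul_pow_le hks #T
    rw [card_filter_powersetCard_subset _ _ _ hTs hTk]
    refine le_of_mul_le_mul_left ?_ hchooseT
    rw [← hmul]
    linarith [mul_le_mul_of_nonneg_right hle hchoose.le]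
  · rw [filter_eq_empty_iff.2 fun J hJ hTJ => ?_, card_empty, Nat.cast_zero]
    · positivity
    · have := card_le_card hTJ
      rw [(mem_powersetCard.1 hJ).2] at this
      lia

-- Sampling without replacement is dominated by independent sampling.
lemma expect_prod_one_add_le_exp (hks : k ≤ #s) {z : ι → ℝ} (hz : ∀ i ∈ s, 0 ≤ z i) :
    𝔼 J ∈ s.powersetCard k, ∏ i ∈ J, (1 + z i) ≤ Real.exp (k / #s * ∑ i ∈ s, z i) := by
  classical
  have hexpand : ∀ J ∈ s.powersetCard k, ∏ i ∈ J, (1 + z i)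
      = ∑ T ∈ s.powerset, {J | T ⊆ J}.indicator (1 : Finset ι → ℝ) J * ∏ i ∈ T, z i := by
    intro J hJ
    rw [prod_one_add]
    refine sum_subset_zero_on_sdiff (powerset_mono.2 (mem_powersetCard.1 hJ).1) ?_ ?_
    · intro T hT
      have : ¬ T ⊆ J := by simpa using (mem_sdiff.1 hT).2
      simp [this]
    · intro T hT
      simp [mem_powerset.1 hT]
  calc 𝔼 J ∈ s.powersetCard k, ∏ i ∈ J, (1 + z i)
      = ∑ T ∈ s.powerset, subsetProb s k {J | T ⊆ J} * ∏ i ∈ T, z i := by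
        rw [expect_congr rfl hexpand, expect_sum_comm]
        simp only [subsetProb, expect_mul]
    _ ≤ ∑ T ∈ s.powerset, ∏ i ∈ T, (k / #s * z i) := by
        refine sum_le_sum fun T hT => ?_
        have hTs := mem_powerset.1 hT
        rw [prod_mul_distrib, prod_const]
        exact mul_le_mul_of_nonneg_right (subsetProb_superset_le hTs hks)
          (prod_nonneg fun i hi => hz i (hTs hi))
    _ = ∏ i ∈ s, (1 + k / #s * z i) := (prod_one_add s).symm
    _ ≤ ∏ i ∈ s, Real.exp (k / #s * z i) := by
        refine prod_le_prod (fun i hi => ?_) fun i _ => ?_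
        · have := hz i hi
          positivity
        · rw [add_comm]
          exact Real.add_one_le_exp _
    _ = Real.exp (k / #s * ∑ i ∈ s, z i) := by rw [mul_sum, Real.exp_sum]

lemma expect_exp_mul_sum_le (hks : k ≤ #s) {x : ι → ℝ} {M avg θ : ℝ} (hx0 : ∀ i ∈ s, 0 ≤ x i)
    (hxM : ∀ i ∈ s, x i ≤ M) (havg : k / #s * ∑ i ∈ s, x i ≤ avg) (hθ : 0 ≤ θ) (hθM : θ * M ≤ 1) :
    𝔼 J ∈ s.powersetCard k, Real.exp (θ * ∑ i ∈ J, x i)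
      ≤ Real.exp (θ * avg + θ ^ 2 * (k * M ^ 2)) := by
  have hz0 : ∀ i ∈ s, 0 ≤ Real.exp (θ * x i) - 1 := fun i hi =>
    sub_nonneg.2 (Real.one_le_exp (mul_nonneg hθ (hx0 i hi)))
  have hz : ∀ i ∈ s, Real.exp (θ * x i) - 1 ≤ θ * x i + θ ^ 2 * M ^ 2 := by
    intro i hi
    have hθx : 0 ≤ θ * x i := mul_nonneg hθ (hx0 i hi)
    have hθxM : θ * x i ≤ θ * M := mul_le_mul_of_nonneg_left (hxM i hi) hθ
    have htaylor := (abs_le.1 (Real.abs_exp_sub_one_sub_id_le (x := θ * x i)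
      (by rw [abs_of_nonneg hθx]; linarith))).2
    have hsq : (θ * x i) ^ 2 ≤ (θ * M) ^ 2 := pow_le_pow_left₀ hθx hθxM 2
    rw [mul_pow θ M] at hsq
    linarith
  have hcard : (k : ℝ) / #s * #s ≤ k := by
    rcases eq_or_ne (#s : ℝ) 0 with h | h
    · simp [h]
    · rw [div_mul_cancel₀ _ h]
  have hsum : (k : ℝ) / #s * ∑ i ∈ s, (Real.exp (θ * x i) - 1)
      ≤ θ * avg + θ ^ 2 * (k * M ^ 2) := by
    calc (k : ℝ) / #s * ∑ i ∈ s, (Real.exp (θ * x i) - 1)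
        ≤ k / #s * ∑ i ∈ s, (θ * x i + θ ^ 2 * M ^ 2) :=
          mul_le_mul_of_nonneg_left (sum_le_sum hz) (by positivity)
      _ = θ * (k / #s * ∑ i ∈ s, x i) + θ ^ 2 * (k / #s * #s * M ^ 2) := by
          rw [sum_add_distrib, ← mul_sum, sum_const, nsmul_eq_mul]
          ring
      _ ≤ θ * avg + θ ^ 2 * (k * M ^ 2) := by gcongr
  calc 𝔼 J ∈ s.powersetCard k, Real.exp (θ * ∑ i ∈ J, x i)
      = 𝔼 J ∈ s.powersetCard k, ∏ i ∈ J, (1 + (Real.exp (θ * x i) - 1)) := by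
        simp only [mul_sum, Real.exp_sum, add_sub_cancel]
    _ ≤ Real.exp (k / #s * ∑ i ∈ s, (Real.exp (θ * x i) - 1)) := expect_prod_one_add_le_exp hks hz0
    _ ≤ Real.exp (θ * avg + θ ^ 2 * (k * M ^ 2)) := Real.exp_le_exp.2 hsum

lemma subsetProb_sum_ge_eq_zero {x : ι → ℝ} {M y : ℝ} (hxM : ∀ i ∈ s, x i ≤ M) (hy : k * M < y) :
    subsetProb s k {J | y ≤ ∑ i ∈ J, x i} = 0 := by
  refine expect_eq_zero fun J hJ =>
    Set.indicator_of_notMem (s := {J | y ≤ ∑ i ∈ J, x i}) (fun hle : y ≤ ∑ i ∈ J, x i => ?_) _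
  obtain ⟨hJs, rfl⟩ := mem_powersetCard.1 hJ
  have hsum : ∑ i ∈ J, x i ≤ #J * M := by
    simpa using sum_le_card_nsmul J x M fun i hi => hxM i (hJs hi)
  linarith

lemma subsetProb_sum_ge_le (hks : k ≤ #s) {x : ι → ℝ} {M avg t E : ℝ} (hx0 : ∀ i ∈ s, 0 ≤ x i)
    (hxM : ∀ i ∈ s, x i ≤ M) (hM : 0 ≤ M) (ht : 0 < t) (havg : k / #s * ∑ i ∈ s, x i ≤ avg)
    (hE : 4 * (k * M ^ 2) * E ≤ t ^ 2) :
    subsetProb s k {J | avg + t ≤ ∑ i ∈ J, x i} ≤ Real.exp (-E) := by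
  rcases lt_or_ge (2 * (k * M)) t with hkMt | hkMt
  · have havg0 : 0 ≤ avg := le_trans (mul_nonneg (by positivity) (sum_nonneg hx0)) havg
    rw [subsetProb_sum_ge_eq_zero hxM (by linarith [mul_nonneg k.cast_nonneg hM])]
    exact (Real.exp_pos _).le
  have hkM : 0 < (k : ℝ) * M := by linarith
  have hM0 : 0 < M := pos_of_mul_pos_right hkM k.cast_nonneg
  have hk0 : 0 < (k : ℝ) := pos_of_mul_pos_left hkM hM
  obtain ⟨θ, hθ⟩ : ∃ θ, θ * (2 * (k * M ^ 2)) = t := ⟨t / (2 * (k * M ^ 2)), by field_simp⟩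
  have hθ0 : 0 < θ := pos_of_mul_pos_left (hθ ▸ ht) (by positivity)
  have hθM : θ * M ≤ 1 := by
    refine le_of_mul_le_mul_right ?_ (show 0 < 2 * (k * M) by positivity)
    calc θ * M * (2 * (k * M)) = θ * (2 * (k * M ^ 2)) := by ring
      _ ≤ 1 * (2 * (k * M)) := by rw [hθ, one_mul]; exact hkMt
  have hexponent : θ * avg + θ ^ 2 * (k * M ^ 2) ≤ -E + θ * (avg + t) := by
    have : E ≤ θ ^ 2 * (k * M ^ 2) := by
      refine le_of_mul_le_mul_left (hE.trans_eq ?_) (show 0 < 4 * (k * M ^ 2) by positivity)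
      rw [← hθ]
      ring
    rw [← hθ]
    linarith
  refine le_of_mul_le_mul_right ?_ (Real.exp_pos (θ * (avg + t)))
  calc subsetProb s k {J | avg + t ≤ ∑ i ∈ J, x i} * Real.exp (θ * (avg + t))
      ≤ 𝔼 J ∈ s.powersetCard k, Real.exp (θ * ∑ i ∈ J, x i) :=
        subsetProb_mul_le_expect (fun _ _ => (Real.exp_pos _).le) fun J _ hJ =>
          Real.exp_le_exp.2 (mul_le_mul_of_nonneg_left hJ hθ0.le)
    _ ≤ Real.exp (θ * avg + θ ^ 2 * (k * M ^ 2)) :=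
        expect_exp_mul_sum_le hks hx0 hxM havg hθ0.le hθM
    _ ≤ Real.exp (-E) * Real.exp (θ * (avg + t)) := by
        rw [← Real.exp_add]
        exact Real.exp_le_exp.2 hexponent

lemma subsetProb_exists_sum_erase_ge_le [DecidableEq ι] (hks : k + 1 ≤ #s) {x : ι → ι → ℝ}
    {M avg t E : ℝ} (hx0 : ∀ j ∈ s, ∀ i ∈ s.erase j, 0 ≤ x i j)
    (hxM : ∀ j ∈ s, ∀ i ∈ s.erase j, x i j ≤ M) (hM : 0 ≤ M) (ht : 0 < t)
    (havg : ∀ j ∈ s, k / ((#s : ℝ) - 1) * ∑ i ∈ s.erase j, x i j ≤ avg)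
    (hE : 4 * (k * M ^ 2) * E ≤ t ^ 2) :
    subsetProb s (k + 1) {I | ∃ j ∈ I, avg + t ≤ ∑ i ∈ I.erase j, x i j}
      ≤ (k + 1) * Real.exp (-E) := by
  refine subsetProb_exists_mem_erase_le (G := fun j => {J | avg + t ≤ ∑ i ∈ J, x i j})
    (Real.exp_pos _).le fun j hj => ?_
  refine subsetProb_sum_ge_le ?_ (hx0 j hj) (hxM j hj) hM ht ?_ hE
  · rw [card_erase_of_mem hj]
    lia
  · rw [cast_card_erase_of_mem hj]
    exact havg j hj

end SubsetSums

section Decoupling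

lemma pow_expect_le_expect_pow_of_even {ι : Type*} {s : Finset ι} (hs : s.Nonempty) (f : ι → ℝ)
    {p : ℕ} (hp : Even p) : (𝔼 i ∈ s, f i) ^ p ≤ 𝔼 i ∈ s, f i ^ p := by
  have hcard : (#s : ℝ) ≠ 0 := by exact_mod_cast hs.card_ne_zero
  have hjensen := Real.pow_arith_mean_le_arith_mean_pow_of_even s (fun _ => (#s : ℝ)⁻¹) f
    (fun _ _ => by positivity) (by rw [sum_const, nsmul_eq_mul, mul_inv_cancel₀ hcard]) hp
  simpa only [expect_eq_sum_div_card, sum_div, inv_mul_eq_div] using hjensen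

variable {ι : Type*} [DecidableEq ι]

lemma four_mul_card_filter_powerset_mem_notMem {I : Finset ι} {i j : ι} (hi : i ∈ I) (hj : j ∈ I)
    (hij : i ≠ j) : 4 * #{T ∈ I.powerset | i ∈ T ∧ j ∉ T} = 2 ^ #I := by
  have hIcc : {T ∈ I.powerset | i ∈ T ∧ j ∉ T} = Icc {i} (I.erase j) := by
    ext T
    simp only [mem_filter, mem_powerset, mem_Icc, singleton_subset_iff, subset_erase]
    tauto
  have hcard : 2 ≤ #I := by
    rw [← card_pair hij]
    exact card_le_card (insert_subset hi (singleton_subset_iff.2 hj))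
  obtain ⟨r, hr⟩ := Nat.exists_eq_add_of_le hcard
  rw [hIcc, card_Icc_finset (singleton_subset_iff.2 (mem_erase.2 ⟨hij, hi⟩)), card_singleton,
    card_erase_of_mem hj, hr, show 2 + r - 1 - 1 = r by lia, pow_add]
  norm_num

lemma sum_sum_sdiff_eq_sum_sum_ite {I T : Finset ι} (hT : T ⊆ I) (f : ι → ι → ℝ) :
    ∑ i ∈ T, ∑ j ∈ I \ T, f i j = ∑ i ∈ I, ∑ j ∈ I, if i ∈ T ∧ j ∉ T then f i j else 0 := by
  simp only [ite_and]
  rw [← sum_subset hT fun i _ hi => by simp [hi]]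
  refine sum_congr rfl fun i hi => ?_
  simp only [hi, if_true]
  rw [← sum_filter, filter_notMem_eq_sdiff]

lemma four_mul_expect_sum_sum_sdiff (I : Finset ι) {f : ι → ι → ℝ} (hf : ∀ i, f i i = 0) :
    4 * 𝔼 T ∈ I.powerset, ∑ i ∈ T, ∑ j ∈ I \ T, f i j = ∑ i ∈ I, ∑ j ∈ I, f i j := by
  have hpair : ∀ i ∈ I, ∀ j ∈ I,
      4 * 𝔼 T ∈ I.powerset, (if i ∈ T ∧ j ∉ T then f i j else 0) = f i j := by
    intro i hi j hj
    rcases eq_or_ne i j with rfl | hij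
    · simp [hf]
    have hcount : (4 : ℝ) * #{T ∈ I.powerset | i ∈ T ∧ j ∉ T} = 2 ^ #I := by
      exact_mod_cast four_mul_card_filter_powerset_mem_notMem hi hj hij
    rw [expect_eq_sum_div_card, ← sum_filter, sum_const, nsmul_eq_mul, card_powerset,
      mul_div_assoc', ← mul_assoc, hcount]
    push_cast
    exact mul_div_cancel_left₀ _ (by positivity)
  rw [expect_congr rfl fun T hT => sum_sum_sdiff_eq_sum_sum_ite (mem_powerset.1 hT) f,
    expect_sum_comm, mul_sum]
  refine sum_congr rfl fun i hi => ?_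
  rw [expect_sum_comm, mul_sum]
  exact sum_congr rfl fun j hj => hpair i hi j hj

variable {κ : Type*}

/-- Column `j` of `H` with the coordinates outside `T` set to `0`, so that the submatrix with rows
in `T` and columns in `J` acts on full vectors. -/
def maskCol (H : Matrix ι κ ℝ) (T : Finset ι) (j : κ) (i : ι) : ℝ :=
  if i ∈ T then H i j else 0

variable [Fintype ι]

lemma maskCol_dotProduct (H : Matrix ι κ ℝ) (T : Finset ι) (j : κ) (x : ι → ℝ) :
    maskCol H T j ⬝ᵥ x = ∑ i ∈ T, H i j * x i := by
  simp [dotProduct, maskCol, ite_mul]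

lemma maskCol_dotProduct_self (H : Matrix ι κ ℝ) (T : Finset ι) (j : κ) :
    maskCol H T j ⬝ᵥ maskCol H T j = ∑ i ∈ T, H i j ^ 2 := by
  rw [maskCol_dotProduct]
  exact sum_congr rfl fun i hi => by rw [maskCol, if_pos hi, sq]

lemma sum_sum_mul_mul_pow_le (H : Matrix ι κ ℝ) (T : Finset ι) (J : Finset κ) (x : ι → ℝ)
    (y : κ → ℝ) {q : ℕ} (hq : q ≠ 0) :
    (∑ i ∈ T, ∑ j ∈ J, x i * H i j * y j) ^ (2 * q)
      ≤ ((∑ i ∈ T, x i ^ 2) * ∑ j ∈ J, y j ^ 2) ^ q * (rankOneSum (maskCol H T) J ^ q).trace := by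
  set z : ι → ℝ := fun i => if i ∈ T then x i else 0 with hz
  have hzz : z ⬝ᵥ z = ∑ i ∈ T, x i ^ 2 := by simp [dotProduct, hz, sq]
  have hsum : ∑ i ∈ T, ∑ j ∈ J, x i * H i j * y j = ∑ j ∈ J, y j * (maskCol H T j ⬝ᵥ z) := by
    rw [sum_comm]
    refine sum_congr rfl fun j _ => ?_
    rw [maskCol_dotProduct, mul_sum]
    refine sum_congr rfl fun i hi => ?_
    simp only [hz, hi, if_true]
    ring
  have hcauchy : (∑ i ∈ T, ∑ j ∈ J, x i * H i j * y j) ^ 2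
      ≤ (∑ j ∈ J, y j ^ 2) * (z ⬝ᵥ (rankOneSum (maskCol H T) J *ᵥ z)) := by
    rw [hsum, dotProduct_rankOneSum_mulVec]
    exact sum_mul_sq_le_sq_mul_sq _ _ _
  calc (∑ i ∈ T, ∑ j ∈ J, x i * H i j * y j) ^ (2 * q)
      ≤ ((∑ j ∈ J, y j ^ 2) * (z ⬝ᵥ (rankOneSum (maskCol H T) J *ᵥ z))) ^ q := by
        rw [pow_mul]
        gcongr
    _ = (∑ j ∈ J, y j ^ 2) ^ q * (z ⬝ᵥ (rankOneSum (maskCol H T) J *ᵥ z)) ^ q := mul_pow _ _ _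
    _ ≤ (∑ j ∈ J, y j ^ 2) ^ q * ((z ⬝ᵥ z) ^ q * (rankOneSum (maskCol H T) J ^ q).trace) :=
        mul_le_mul_of_nonneg_left (dotProduct_mulVec_pow_le_trace (rankOneSum_posSemidef _ _) z hq)
          (by positivity)
    _ = ((∑ i ∈ T, x i ^ 2) * ∑ j ∈ J, y j ^ 2) ^ q * (rankOneSum (maskCol H T) J ^ q).trace := by
        rw [hzz, mul_pow]
        ring

-- A uniformly random splitting of `I` into `T` and `I \ T` separates each pair of distinct indices
-- in a given order with probability `1 / 4`.
lemma quadForm_pow_le_expect_trace {H : Matrix ι ι ℝ} (hH : ∀ i, H i i = 0) (I : Finset ι)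
    (x : ι → ℝ) {q : ℕ} (hq : q ≠ 0) :
    (∑ i ∈ I, ∑ j ∈ I, x i * H i j * x j) ^ (2 * q) ≤ (∑ i ∈ I, x i ^ 2) ^ (2 * q)
      * (4 ^ q * 𝔼 T ∈ I.powerset, (rankOneSum (maskCol H T) (I \ T) ^ q).trace) := by
  set y := ∑ i ∈ I, x i ^ 2 with hy
  have hcross : ∀ T ∈ I.powerset, (∑ i ∈ T, ∑ j ∈ I \ T, x i * H i j * x j) ^ (2 * q)
      ≤ (y ^ 2 / 4) ^ q * (rankOneSum (maskCol H T) (I \ T) ^ q).trace := by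
    intro T hT
    refine (sum_sum_mul_mul_pow_le H T (I \ T) x x hq).trans ?_
    have hamgm : (∑ i ∈ T, x i ^ 2) * ∑ j ∈ I \ T, x j ^ 2 ≤ y ^ 2 / 4 := by
      rw [hy, ← sum_sdiff (mem_powerset.1 hT)]
      nlinarith [sq_nonneg (∑ j ∈ I \ T, x j ^ 2 - ∑ j ∈ T, x j ^ 2)]
    have htrace : 0 ≤ (rankOneSum (maskCol H T) (I \ T) ^ q).trace :=
      ((rankOneSum_posSemidef _ _).pow q).trace_nonneg
    gcongr
  have hpow : (4 : ℝ) ^ (2 * q) * (y ^ 2 / 4) ^ q = y ^ (2 * q) * 4 ^ q := by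
    rw [pow_mul, pow_mul, ← mul_pow, ← mul_pow]
    ring
  calc (∑ i ∈ I, ∑ j ∈ I, x i * H i j * x j) ^ (2 * q)
      = 4 ^ (2 * q) * (𝔼 T ∈ I.powerset, ∑ i ∈ T, ∑ j ∈ I \ T, x i * H i j * x j) ^ (2 * q) := by
        rw [← four_mul_expect_sum_sum_sdiff I (f := fun i j => x i * H i j * x j)
          (fun i => by simp [hH]), mul_pow]
    _ ≤ 4 ^ (2 * q) * 𝔼 T ∈ I.powerset, (∑ i ∈ T, ∑ j ∈ I \ T, x i * H i j * x j) ^ (2 * q) := by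
        gcongr
        exact pow_expect_le_expect_pow_of_even (powerset_nonempty I) _ (even_two_mul q)
    _ ≤ 4 ^ (2 * q) * 𝔼 T ∈ I.powerset,
          (y ^ 2 / 4) ^ q * (rankOneSum (maskCol H T) (I \ T) ^ q).trace :=
        mul_le_mul_of_nonneg_left (expect_le_expect hcross) (by positivity)
    _ = y ^ (2 * q) * (4 ^ q * 𝔼 T ∈ I.powerset, (rankOneSum (maskCol H T) (I \ T) ^ q).trace) := by
        rw [← mul_expect, ← mul_assoc, hpow, mul_assoc]

end Decoupling

section Splitting

variable {ι : Type*} [DecidableEq ι]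

lemma sum_powersetCard_sum_powersetCard_sdiff {M : Type*} [AddCommMonoid M] (S : Finset ι)
    {s k : ℕ} (hsk : s ≤ k) (F : Finset ι → Finset ι → M) :
    ∑ I ∈ S.powersetCard k, ∑ T ∈ I.powersetCard s, F T (I \ T)
      = ∑ T ∈ S.powersetCard s, ∑ J ∈ (S \ T).powersetCard (k - s), F T J := by
  rw [sum_sigma', sum_sigma']
  refine sum_bij' (fun p _ => ⟨p.2, p.1 \ p.2⟩) (fun p _ => ⟨p.1 ∪ p.2, p.1⟩) ?_ ?_ ?_ ?_ ?_
  · rintro ⟨I, T⟩ h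
    simp only [mem_sigma, mem_powersetCard] at h ⊢
    obtain ⟨⟨hIS, hIk⟩, hTI, hTs⟩ := h
    exact ⟨⟨hTI.trans hIS, hTs⟩, sdiff_subset_sdiff hIS le_rfl,
      by rw [card_sdiff_of_subset hTI, hIk, hTs]⟩
  · rintro ⟨T, J⟩ h
    simp only [mem_sigma, mem_powersetCard] at h ⊢
    obtain ⟨⟨hTS, hTs⟩, hJ, hJk⟩ := h
    have hdisj : Disjoint T J := disjoint_of_subset_right hJ disjoint_sdiff
    exact ⟨⟨union_subset hTS (hJ.trans sdiff_subset),
      by rw [card_union_of_disjoint hdisj, hTs, hJk]; lia⟩, subset_union_left, hTs⟩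
  · rintro ⟨I, T⟩ h
    simp only [mem_sigma, mem_powersetCard] at h
    simp [union_eq_right.2 h.2.1]
  · rintro ⟨T, J⟩ h
    simp only [mem_sigma, mem_powersetCard] at h
    have hdisj : Disjoint T J := disjoint_of_subset_right h.2.1 disjoint_sdiff
    simp [union_sdiff_cancel_left hdisj]
  · rintro ⟨I, T⟩ _
    rfl

lemma expect_powersetCard_expect_powersetCard_sdiff (S : Finset ι) {s k : ℕ} (hsk : s ≤ k)
    (F : Finset ι → Finset ι → ℝ) :
    𝔼 I ∈ S.powersetCard k, 𝔼 T ∈ I.powersetCard s, F T (I \ T)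
      = 𝔼 T ∈ S.powersetCard s, 𝔼 J ∈ (S \ T).powersetCard (k - s), F T J := by
  have hleft : ∀ I ∈ S.powersetCard k, 𝔼 T ∈ I.powersetCard s, F T (I \ T)
      = (∑ T ∈ I.powersetCard s, F T (I \ T)) / k.choose s := by
    intro I hI
    rw [expect_eq_sum_div_card, card_powersetCard, (mem_powersetCard.1 hI).2]
  have hright : ∀ T ∈ S.powersetCard s, 𝔼 J ∈ (S \ T).powersetCard (k - s), F T J
      = (∑ J ∈ (S \ T).powersetCard (k - s), F T J) / (#S - s).choose (k - s) := by
    intro T hT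
    obtain ⟨hTS, hTs⟩ := mem_powersetCard.1 hT
    rw [expect_eq_sum_div_card, card_powersetCard, card_sdiff_of_subset hTS, hTs]
  have hchoose : ((k.choose s : ℝ)) * (#S).choose k
      = (#S - s).choose (k - s) * (#S).choose s := by
    exact_mod_cast (mul_comm _ _).trans ((Nat.choose_mul hsk).trans (mul_comm _ _))
  rw [expect_congr rfl hleft, expect_congr rfl hright, ← expect_div, ← expect_div,
    expect_eq_sum_div_card, expect_eq_sum_div_card, div_div, div_div, card_powersetCard,
    card_powersetCard, sum_powersetCard_sum_powersetCard_sdiff S hsk, mul_comm _ (k.choose s : ℝ),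
    hchoose, mul_comm _ ((#S).choose s : ℝ)]

lemma expect_expect_powerset_le {S : Finset ι} {k : ℕ} {F : Finset ι → Finset ι → ℝ} {B : ℝ}
    (hF : ∀ s ≤ k, 𝔼 T ∈ S.powersetCard s, 𝔼 J ∈ (S \ T).powersetCard (k - s), F T J ≤ B) :
    𝔼 I ∈ S.powersetCard k, 𝔼 T ∈ I.powerset, F T (I \ T) ≤ B := by
  have hlayers : ∀ I ∈ S.powersetCard k, 𝔼 T ∈ I.powerset, F T (I \ T)
      = ∑ s ∈ range (k + 1), k.choose s / 2 ^ k * 𝔼 T ∈ I.powersetCard s, F T (I \ T) := by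
    intro I hI
    obtain ⟨-, rfl⟩ := mem_powersetCard.1 hI
    rw [expect_eq_sum_div_card, sum_powerset, card_powerset, sum_div]
    refine sum_congr rfl fun s _ => ?_
    rw [div_mul_eq_mul_div, ← card_powersetCard, card_mul_expect]
    push_cast
    rfl
  rw [expect_congr rfl hlayers, expect_sum_comm]
  calc ∑ s ∈ range (k + 1), 𝔼 I ∈ S.powersetCard k,
        k.choose s / 2 ^ k * 𝔼 T ∈ I.powersetCard s, F T (I \ T)
      ≤ ∑ s ∈ range (k + 1), (k.choose s / 2 ^ k : ℝ) * B := by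
        refine sum_le_sum fun s hs => ?_
        have hsk : s ≤ k := Nat.lt_succ_iff.1 (mem_range.1 hs)
        rw [← mul_expect, expect_powersetCard_expect_powersetCard_sdiff S hsk]
        exact mul_le_mul_of_nonneg_left (hF s hsk) (by positivity)
    _ = B := by
        have hsum : (∑ s ∈ range (k + 1), (k.choose s : ℝ)) = 2 ^ k := by
          exact_mod_cast Nat.sum_range_choose k
        rw [← sum_mul, ← sum_div, hsum, div_self (by positivity), one_mul]

end Splitting

section TruncatedColumns

variable {ι κ : Type*} [Fintype ι] [DecidableEq ι]

/-- The masked column, replaced by `0` when its squared norm exceeds `R`: a version of `maskCol`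
whose length is bounded for every `T`, not only for the typical ones. -/
noncomputable def truncCol (H : Matrix ι κ ℝ) (R : ℝ) (T : Finset ι) (j : κ) : ι → ℝ :=
  if maskCol H T j ⬝ᵥ maskCol H T j ≤ R then maskCol H T j else 0

lemma truncCol_dotProduct_self_le (H : Matrix ι κ ℝ) {R : ℝ} (hR : 0 ≤ R) (T : Finset ι) (j : κ) :
    truncCol H R T j ⬝ᵥ truncCol H R T j ≤ R := by
  rw [truncCol]
  split_ifs with h
  · exact h
  · simpa using hR

lemma truncCol_apply_of_notMem (H : Matrix ι κ ℝ) (R : ℝ) {T : Finset ι} (j : κ) {i : ι}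
    (hi : i ∉ T) : truncCol H R T j i = 0 := by
  rw [truncCol]
  split_ifs
  · exact if_neg hi
  · rfl

lemma truncCol_dotProduct_sq_le (H : Matrix ι κ ℝ) (R : ℝ) (T : Finset ι) (j : κ) (x : ι → ℝ) :
    (truncCol H R T j ⬝ᵥ x) ^ 2 ≤ (∑ i ∈ T, H i j * x i) ^ 2 := by
  rw [truncCol]
  split_ifs
  · rw [maskCol_dotProduct]
  · rw [zero_dotProduct, zero_pow two_ne_zero]
    positivity

lemma sum_truncCol_dotProduct_self_le {H : Matrix ι κ ℝ} {T : Finset ι} {lam R : ℝ}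
    {S : Finset κ} (hlam : ∀ x, ∑ j ∈ S, (truncCol H R T j ⬝ᵥ x) ^ 2 ≤ lam * (x ⬝ᵥ x)) :
    ∑ j ∈ S, truncCol H R T j ⬝ᵥ truncCol H R T j ≤ #T * lam := by
  have hself : ∀ j, truncCol H R T j ⬝ᵥ truncCol H R T j
      = ∑ i ∈ T, (truncCol H R T j ⬝ᵥ Pi.single i 1) ^ 2 := by
    intro j
    simp only [dotProduct_single, mul_one, sq]
    exact (sum_subset (subset_univ T) fun i _ hi => by
      rw [truncCol_apply_of_notMem H R j hi, mul_zero]).symm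
  simp only [hself]
  rw [sum_comm, ← nsmul_eq_mul]
  exact sum_le_card_nsmul T _ lam fun i _ => by simpa using hlam (Pi.single i 1)

lemma rankOneSum_maskCol_eq_truncCol {H : Matrix ι ι ℝ} {R : ℝ} {I T : Finset ι}
    (hT : T ⊆ I) (hI : ∀ j ∈ I, ∑ i ∈ I.erase j, H i j ^ 2 ≤ R) :
    rankOneSum (maskCol H T) (I \ T) = rankOneSum (truncCol H R T) (I \ T) := by
  refine sum_congr rfl fun j hj => ?_
  obtain ⟨hjI, hjT⟩ := mem_sdiff.1 hj
  have hTerase : T ⊆ I.erase j := fun i hi => mem_erase.2 ⟨ne_of_mem_of_not_mem hi hjT, hT hi⟩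
  have hshort : maskCol H T j ⬝ᵥ maskCol H T j ≤ R := by
    rw [maskCol_dotProduct_self]
    exact (sum_le_sum_of_subset_of_nonneg hTerase fun _ _ _ => sq_nonneg _).trans (hI j hjI)
  rw [truncCol, if_pos hshort]

end TruncatedColumns

section TruncatedMoments

variable {ι κ : Type*} [Fintype κ]

lemma sum_smul_dotProduct_self_le {v : ι → κ → ℝ} {T : Finset ι} {lam : ℝ} (hlam0 : 0 ≤ lam)
    (hlam : ∀ y, ∑ i ∈ T, (v i ⬝ᵥ y) ^ 2 ≤ lam * (y ⬝ᵥ y)) (x : ι → ℝ) :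
    (∑ i ∈ T, x i • v i) ⬝ᵥ (∑ i ∈ T, x i • v i) ≤ lam * ∑ i ∈ T, x i ^ 2 := by
  set u := ∑ i ∈ T, x i • v i with hu
  have huu : u ⬝ᵥ u = ∑ i ∈ T, x i * (v i ⬝ᵥ u) := by
    conv_lhs => rw [hu, sum_dotProduct]
    exact sum_congr rfl fun i _ => by rw [smul_dotProduct, smul_eq_mul, hu]
  have hcauchy : (u ⬝ᵥ u) ^ 2 ≤ (∑ i ∈ T, x i ^ 2) * (lam * (u ⬝ᵥ u)) := by
    calc (u ⬝ᵥ u) ^ 2 ≤ (∑ i ∈ T, x i ^ 2) * ∑ i ∈ T, (v i ⬝ᵥ u) ^ 2 := by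
          rw [huu]
          exact sum_mul_sq_le_sq_mul_sq _ _ _
      _ ≤ _ := mul_le_mul_of_nonneg_left (hlam u) (by positivity)
  rcases (dotProduct_self_nonneg u).eq_or_lt with h | h
  · rw [← h]
    positivity
  · refine le_of_mul_le_mul_right ?_ h
    linarith

lemma sum_truncCol_dotProduct_sq_le [Fintype ι] [DecidableEq ι] {H : Matrix ι κ ℝ} {T : Finset ι}
    {lam : ℝ} (hlam0 : 0 ≤ lam) (hlam : ∀ y, ∑ i ∈ T, (H.row i ⬝ᵥ y) ^ 2 ≤ lam * (y ⬝ᵥ y))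
    (R : ℝ) (S : Finset κ) (x : ι → ℝ) :
    ∑ j ∈ S, (truncCol H R T j ⬝ᵥ x) ^ 2 ≤ lam * (x ⬝ᵥ x) := by
  have hcomb : ∀ j, ∑ i ∈ T, H i j * x i = (∑ i ∈ T, x i • H.row i) j := fun j => by
    simp [Finset.sum_apply, mul_comm]
  calc ∑ j ∈ S, (truncCol H R T j ⬝ᵥ x) ^ 2 ≤ ∑ j ∈ S, (∑ i ∈ T, H i j * x i) ^ 2 :=
        sum_le_sum fun j _ => truncCol_dotProduct_sq_le H R T j x
    _ ≤ ∑ j, (∑ i ∈ T, H i j * x i) ^ 2 :=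
        sum_le_sum_of_subset_of_nonneg (subset_univ S) fun _ _ _ => sq_nonneg _
    _ = (∑ i ∈ T, x i • H.row i) ⬝ᵥ (∑ i ∈ T, x i • H.row i) := by
        simp only [hcomb, dotProduct, sq]
    _ ≤ lam * ∑ i ∈ T, x i ^ 2 := sum_smul_dotProduct_self_le hlam0 hlam x
    _ ≤ lam * (x ⬝ᵥ x) := by
        simp only [dotProduct, ← sq]
        gcongr
        exact subset_univ T

variable [DecidableEq κ]

lemma dotProduct_mulVec_le_rpow_trace {A : Matrix κ κ ℝ} (hA : A.PosSemidef) {q : ℕ} (hq : q ≠ 0)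
    (x : κ → ℝ) : x ⬝ᵥ (A *ᵥ x) ≤ (A ^ q).trace ^ (q : ℝ)⁻¹ * (x ⬝ᵥ x) := by
  have htrace : 0 ≤ (A ^ q).trace := (hA.pow q).trace_nonneg
  have hx := dotProduct_self_nonneg x
  refine le_of_pow_le_pow_left₀ hq (by positivity) ?_
  rw [mul_pow, Real.rpow_inv_natCast_pow htrace hq, mul_comm]
  exact dotProduct_mulVec_pow_le_trace hA x hq

lemma expect_trace_rankOneSum_pow_le_of_card {S : Finset ι} {v : ι → κ → ℝ}
    {R lam ρ D : ℝ} {q k : ℕ} (hR : 0 ≤ R) (hρ : 0 ≤ ρ) (hv : ∀ i ∈ S, v i ⬝ᵥ v i ≤ R)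
    (hlam : ∀ x, ∑ i ∈ S, (v i ⬝ᵥ x) ^ 2 ≤ lam * (x ⬝ᵥ x)) (hlam0 : 0 ≤ lam)
    (hkρ : (k : ℝ) ≤ ρ * ((#S : ℝ) - k + 1)) (hD : ρ * #S ≤ 2 * D) (hq : 2 ≤ q) :
    𝔼 I ∈ S.powersetCard k, (rankOneSum v I ^ q).trace
      ≤ D * ((q * R) ^ q + (3 * (ρ * lam)) ^ q) := by
  have hD0 : 0 ≤ D := by linarith [mul_nonneg hρ (#S).cast_nonneg]
  refine expect_trace_rankOneSum_pow_le_add hR hρ hD0 hv hlam hlam0 hkρ ?_ (by lia)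
  have hq2 : (2 : ℝ) ≤ q := by exact_mod_cast hq
  calc ρ * ∑ i ∈ S, v i ⬝ᵥ v i ≤ ρ * (#S * R) := by
        gcongr
        simpa using sum_le_card_nsmul S _ R hv
    _ ≤ 2 * D * R := by rw [← mul_assoc]; gcongr
    _ = D * (2 * R) := by ring
    _ ≤ D * max (q * R) (3 * (ρ * lam)) := by
        gcongr
        exact le_max_of_le_left (by gcongr)

variable [Fintype ι] [DecidableEq ι]

lemma expect_trace_truncCol_pow_le (H : Matrix ι κ ℝ) {R ρ : ℝ} (hR : 0 ≤ R) (hρ : 0 ≤ ρ)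
    {q k : ℕ} (hq : q ≠ 0) (T : Finset ι) {S : Finset κ}
    (hkρ : (k : ℝ) ≤ ρ * ((#S : ℝ) - k + 1)) :
    𝔼 J ∈ S.powersetCard k, (rankOneSum (truncCol H R T) J ^ q).trace
      ≤ #T * ((q * R) ^ q + (3 * ρ) ^ q * (rankOneSum H.row T ^ q).trace) := by
  have htrace : 0 ≤ (rankOneSum H.row T ^ q).trace :=
    ((rankOneSum_posSemidef _ _).pow q).trace_nonneg
  set lam : ℝ := (rankOneSum H.row T ^ q).trace ^ (q : ℝ)⁻¹
  have hlam0 : 0 ≤ lam := by positivity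
  have hlamq : lam ^ q = (rankOneSum H.row T ^ q).trace := Real.rpow_inv_natCast_pow htrace hq
  have hrows : ∀ y, ∑ i ∈ T, (H.row i ⬝ᵥ y) ^ 2 ≤ lam * (y ⬝ᵥ y) := fun y => by
    rw [← dotProduct_rankOneSum_mulVec]
    exact dotProduct_mulVec_le_rpow_trace (rankOneSum_posSemidef _ _) hq y
  have hcols := sum_truncCol_dotProduct_sq_le hlam0 hrows R S
  rw [← hlamq, ← mul_pow, mul_assoc 3]
  refine expect_trace_rankOneSum_pow_le_add hR hρ (#T).cast_nonneg
    (fun j _ => truncCol_dotProduct_self_le H hR T j) hcols hlam0 hkρ ?_ hq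
  calc ρ * ∑ j ∈ S, truncCol H R T j ⬝ᵥ truncCol H R T j ≤ ρ * (#T * lam) := by
        gcongr
        exact sum_truncCol_dotProduct_self_le hcols
    _ = #T * (ρ * lam) := by ring
    _ ≤ #T * max (q * R) (3 * (ρ * lam)) := by
        gcongr
        exact le_max_of_le_right (by linarith [mul_nonneg hρ hlam0])

end TruncatedMoments

section DecoupledMoments

variable {ι : Type*} [Fintype ι] [DecidableEq ι]

-- Conditionally on the rows `T` the columns `I \ T` are uniform in the complement of `T`; the
-- spectral bound this needs for the rows in `T` is itself controlled by a moment bound over `T`.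
lemma expect_expect_trace_truncCol_pow_le {H : Matrix ι ι ℝ} {S : Finset ι} {R R' lam ρ : ℝ}
    (hR : 0 ≤ R) (hR' : 0 ≤ R') (hlam0 : 0 ≤ lam) (hρ : 0 ≤ ρ) {q k : ℕ} (hq : 2 ≤ q)
    (hkρ : (k : ℝ) ≤ ρ * ((#S : ℝ) - k + 1)) (hρS : ρ * #S ≤ 2 * k)
    (hrow : ∀ i ∈ S, H.row i ⬝ᵥ H.row i ≤ R')
    (hlam : ∀ x, ∑ i ∈ S, (H.row i ⬝ᵥ x) ^ 2 ≤ lam * (x ⬝ᵥ x)) :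
    𝔼 I ∈ S.powersetCard k, 𝔼 T ∈ I.powerset, (rankOneSum (truncCol H R T) (I \ T) ^ q).trace
      ≤ k * ((q * R) ^ q + (3 * ρ) ^ q * (k * ((q * R') ^ q + (3 * (ρ * lam)) ^ q))) := by
  refine expect_expect_powerset_le (F := fun T J => (rankOneSum (truncCol H R T) J ^ q).trace)
    fun s hsk => ?_
  have hskR : (s : ℝ) ≤ k := by exact_mod_cast hsk
  have hkS : k ≤ #S := by
    by_contra! h
    have hcast : (#S : ℝ) + 1 ≤ k := by exact_mod_cast h
    nlinarith [(#S).cast_nonneg (α := ℝ)]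
  have hblock : ∀ T ∈ S.powersetCard s,
      𝔼 J ∈ (S \ T).powersetCard (k - s), (rankOneSum (truncCol H R T) J ^ q).trace
        ≤ k * ((q * R) ^ q + (3 * ρ) ^ q * (rankOneSum H.row T ^ q).trace) := by
    intro T hT
    obtain ⟨hTS, rfl⟩ := mem_powersetCard.1 hT
    have htrace : 0 ≤ (rankOneSum H.row T ^ q).trace :=
      ((rankOneSum_posSemidef _ _).pow q).trace_nonneg
    refine (expect_trace_truncCol_pow_le H hR hρ (by lia) T ?_).trans (by gcongr)
    rw [card_sdiff_of_subset hTS, Nat.cast_sub hsk, Nat.cast_sub (card_le_card hTS),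
      sub_sub_sub_cancel_right]
    linarith [(#T).cast_nonneg (α := ℝ)]
  have hrows : 𝔼 T ∈ S.powersetCard s, (rankOneSum H.row T ^ q).trace
      ≤ k * ((q * R') ^ q + (3 * (ρ * lam)) ^ q) := by
    refine expect_trace_rankOneSum_pow_le_of_card hR' hρ hrow hlam hlam0 ?_ hρS hq
    calc (s : ℝ) ≤ ρ * ((#S : ℝ) - k + 1) := hskR.trans hkρ
      _ ≤ ρ * ((#S : ℝ) - s + 1) := by gcongr
  refine (expect_le_expect hblock).trans ?_
  rw [← mul_expect, expect_add_distrib, ← mul_expect,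
    expect_const (powersetCard_nonempty.2 (hsk.trans hkS))]
  gcongr

end DecoupledMoments

section SpectralNorm

open scoped Matrix.Norms.L2Operator

lemma norm_toLp_sq {n : Type*} [Fintype n] (x : n → ℝ) : ‖WithLp.toLp 2 x‖ ^ 2 = x ⬝ᵥ x := by
  rw [EuclideanSpace.real_norm_sq_eq]
  simp only [dotProduct, sq]

variable {m n : Type*} [Fintype m] [Fintype n] [DecidableEq n]

lemma specNorm_nonneg (A : Matrix m n ℝ) : 0 ≤ specNorm A := norm_nonneg A

lemma mulVec_dotProduct_mulVec_le (A : Matrix m n ℝ) (x : n → ℝ) :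
    (A *ᵥ x) ⬝ᵥ (A *ᵥ x) ≤ specNorm A ^ 2 * (x ⬝ᵥ x) := by
  rw [← norm_toLp_sq, ← norm_toLp_sq, ← mul_pow]
  exact pow_le_pow_left₀ (norm_nonneg _) (l2_opNorm_mulVec A (WithLp.toLp 2 x)) 2

lemma specNorm_le_of_mulVec {A : Matrix m n ℝ} {c : ℝ} (hc : 0 ≤ c)
    (h : ∀ x, (A *ᵥ x) ⬝ᵥ (A *ᵥ x) ≤ c ^ 2 * (x ⬝ᵥ x)) : specNorm A ≤ c := by
  rw [specNorm, l2_opNorm_def]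
  refine ContinuousLinearMap.opNorm_le_bound _ hc fun x => ?_
  have hx := h x.ofLp
  rw [← norm_toLp_sq, ← norm_toLp_sq, ← mul_pow] at hx
  exact le_of_pow_le_pow_left₀ two_ne_zero (by positivity) hx

lemma specNorm_le_of_quadForm {A : Matrix n n ℝ} (hA : A.IsHermitian) {c : ℝ} (hc : 0 ≤ c)
    (h : ∀ x, |x ⬝ᵥ (A *ᵥ x)| ≤ c * (x ⬝ᵥ x)) : specNorm A ≤ c := by
  have heigenvalue : ∀ s, |hA.eigenvalues s| ≤ c := fun s => by
    simpa only [hA.mulVec_eigenvectorBasis, dotProduct_smul, smul_eq_mul,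
      eigenvectorBasis_dotProduct_self, mul_one] using h ⇑(hA.eigenvectorBasis s)
  have hsymm : Aᵀ = A := by rwa [IsHermitian, conjTranspose_eq_transpose_of_trivial] at hA
  refine specNorm_le_of_mulVec hc fun x => ?_
  calc (A *ᵥ x) ⬝ᵥ (A *ᵥ x) = x ⬝ᵥ (A ^ 2 *ᵥ x) := by
        rw [sq, ← mulVec_mulVec, dotProduct_mulVec x, ← mulVec_transpose, hsymm]
    _ = ∑ s, hA.eigenvalues s ^ 2 * spectralWeight hA x s := dotProduct_pow_mulVec hA x 2
    _ ≤ ∑ s, c ^ 2 * spectralWeight hA x s := sum_le_sum fun s _ =>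
        mul_le_mul_of_nonneg_right (sq_le_sq' (abs_le.1 (heigenvalue s)).1
          (abs_le.1 (heigenvalue s)).2) (spectralWeight_nonneg hA x s)
    _ = c ^ 2 * (x ⬝ᵥ x) := by rw [← mul_sum, sum_spectralWeight]

lemma specNorm_submatrix_le_of_quadForm {ι : Type*} [DecidableEq ι] {A : Matrix ι ι ℝ}
    (hA : A.IsHermitian) (I : Finset ι) {c : ℝ} (hc : 0 ≤ c)
    (h : ∀ x : ι → ℝ, |∑ i ∈ I, ∑ j ∈ I, x i * A i j * x j| ≤ c * ∑ i ∈ I, x i ^ 2) :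
    specNorm (A.submatrix (fun i : I => (i : ι)) (fun i : I => (i : ι))) ≤ c := by
  refine specNorm_le_of_quadForm (hA.submatrix _) hc fun x => ?_
  set y : ι → ℝ := fun i => if hi : i ∈ I then x ⟨i, hi⟩ else 0 with hy
  have hyx : ∀ i : I, y i = x i := fun i => by simp [hy]
  simpa only [← sum_coe_sort I, dotProduct, mulVec, submatrix_apply, hyx, mul_sum, mul_assoc, sq]
    using h y

end SpectralNorm

section Coherence

variable {m N : ℕ} (Φ : Matrix (Fin m) (Fin N) ℝ)

lemma coh_le_mutualCoherence {i j : Fin N} (hij : i ≠ j) : coh Φ i j ≤ mutualCoherence Φ :=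
  le_ciSup (f := fun p : {p : Fin N × Fin N // p.1 ≠ p.2} => coh Φ p.1.1 p.1.2)
    (Set.finite_range _).bddAbove ⟨(i, j), hij⟩

lemma inv_mul_sum_coh_sq_le_meanSqCoherence (j : Fin N) :
    1 / ((N : ℝ) - 1) * ∑ i ∈ univ.erase j, coh Φ i j ^ 2 ≤ meanSqCoherence Φ :=
  le_ciSup (f := fun j : Fin N => 1 / ((N : ℝ) - 1) * ∑ i ∈ univ.erase j, coh Φ i j ^ 2)
    (Set.finite_range _).bddAbove j

lemma meanSqCoherence_nonneg (hN : 1 ≤ N) : 0 ≤ meanSqCoherence Φ := by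
  have hN' : (0 : ℝ) ≤ N - 1 := sub_nonneg.2 (by exact_mod_cast hN)
  exact Real.iSup_nonneg fun j => by positivity

end Coherence

section GramMatrix

variable {m N : ℕ}

/-- The Gram matrix of the columns of `Φ` minus the identity. For unit columns it has zero diagonal,
and its principal submatrices are the matrices whose norm `gramDev` measures. -/
def gramOff (Φ : Matrix (Fin m) (Fin N) ℝ) : Matrix (Fin N) (Fin N) ℝ :=
  Φᵀ * Φ - 1

lemma gramOff_isHermitian (Φ : Matrix (Fin m) (Fin N) ℝ) : (gramOff Φ).IsHermitian := by
  rw [IsHermitian, conjTranspose_eq_transpose_of_trivial, gramOff, transpose_sub, transpose_mul,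
    transpose_transpose, transpose_one]

lemma gramOff_self {Φ : Matrix (Fin m) (Fin N) ℝ} (hΦ : UnitColumns Φ) (i : Fin N) :
    gramOff Φ i i = 0 := by
  simp only [gramOff, Matrix.sub_apply, mul_apply, transpose_apply, one_apply_eq, ← sq, hΦ i,
    sub_self]

lemma gramOff_sq (Φ : Matrix (Fin m) (Fin N) ℝ) {i j : Fin N} (hij : i ≠ j) :
    gramOff Φ i j ^ 2 = coh Φ i j ^ 2 := by
  simp [gramOff, coh, mul_apply, one_apply_ne hij, sq_abs]

lemma sum_erase_gramOff_sq (Φ : Matrix (Fin m) (Fin N) ℝ) (j : Fin N) :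
    ∑ i ∈ univ.erase j, gramOff Φ i j ^ 2 = ∑ i ∈ univ.erase j, coh Φ i j ^ 2 :=
  sum_congr rfl fun _ hi => gramOff_sq Φ (ne_of_mem_erase hi)

lemma gramOff_row_dotProduct_self_le {Φ : Matrix (Fin m) (Fin N) ℝ} (hΦ : UnitColumns Φ)
    (hN : 1 < N) (j : Fin N) :
    (gramOff Φ).row j ⬝ᵥ (gramOff Φ).row j ≤ ((N : ℝ) - 1) * meanSqCoherence Φ := by
  have hN' : (0 : ℝ) < N - 1 := sub_pos.2 (by exact_mod_cast hN)
  have hrow : (gramOff Φ).row j ⬝ᵥ (gramOff Φ).row j = ∑ i ∈ univ.erase j, coh Φ i j ^ 2 := by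
    rw [← sum_erase_gramOff_sq, sum_erase _ (by rw [gramOff_self hΦ, zero_pow two_ne_zero])]
    exact sum_congr rfl fun i _ => by
      rw [row_apply, ← (gramOff_isHermitian Φ).apply i j, star_trivial, sq]
  rw [hrow, ← inv_mul_le_iff₀ hN', ← one_div]
  exact inv_mul_sum_coh_sq_le_meanSqCoherence Φ j

lemma one_le_specNorm_sq {Φ : Matrix (Fin m) (Fin N) ℝ} (hΦ : UnitColumns Φ) (j : Fin N) :
    1 ≤ specNorm Φ ^ 2 := by
  have hcol : (Φ *ᵥ Pi.single j 1) ⬝ᵥ (Φ *ᵥ Pi.single j 1) = 1 := by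
    simpa [dotProduct, sq] using hΦ j
  have h := mulVec_dotProduct_mulVec_le Φ (Pi.single j 1)
  rwa [hcol, dotProduct_single_one, Pi.single_eq_same, mul_one] at h

lemma abs_dotProduct_gramOff_mulVec_le {Φ : Matrix (Fin m) (Fin N) ℝ} (hΦ : UnitColumns Φ)
    (x : Fin N → ℝ) : |x ⬝ᵥ (gramOff Φ *ᵥ x)| ≤ specNorm Φ ^ 2 * (x ⬝ᵥ x) := by
  rcases isEmpty_or_nonempty (Fin N) with _ | ⟨⟨j⟩⟩
  · simp [dotProduct]
  have hform : x ⬝ᵥ (gramOff Φ *ᵥ x) = (Φ *ᵥ x) ⬝ᵥ (Φ *ᵥ x) - x ⬝ᵥ x := by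
    rw [gramOff, sub_mulVec, one_mulVec, dotProduct_sub, ← mulVec_mulVec, dotProduct_mulVec x,
      vecMul_transpose]
  have hx : x ⬝ᵥ x ≤ specNorm Φ ^ 2 * (x ⬝ᵥ x) :=
    le_mul_of_one_le_left (dotProduct_self_nonneg x) (one_le_specNorm_sq hΦ j)
  rw [hform, abs_le]
  constructor
  · linarith [dotProduct_self_nonneg (Φ *ᵥ x)]
  · linarith [mulVec_dotProduct_mulVec_le Φ x, dotProduct_self_nonneg x]

lemma sum_gramOff_row_dotProduct_sq_le {Φ : Matrix (Fin m) (Fin N) ℝ} (hΦ : UnitColumns Φ)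
    (x : Fin N → ℝ) :
    ∑ i, ((gramOff Φ).row i ⬝ᵥ x) ^ 2 ≤ (specNorm Φ ^ 2) ^ 2 * (x ⬝ᵥ x) := by
  have hnorm : specNorm (gramOff Φ) ≤ specNorm Φ ^ 2 :=
    specNorm_le_of_quadForm (gramOff_isHermitian Φ) (sq_nonneg _)
      (abs_dotProduct_gramOff_mulVec_le hΦ)
  calc ∑ i, ((gramOff Φ).row i ⬝ᵥ x) ^ 2 = (gramOff Φ *ᵥ x) ⬝ᵥ (gramOff Φ *ᵥ x) :=
        sum_congr rfl fun _ _ => sq _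
    _ ≤ specNorm (gramOff Φ) ^ 2 * (x ⬝ᵥ x) := mulVec_dotProduct_mulVec_le _ x
    _ ≤ (specNorm Φ ^ 2) ^ 2 * (x ⬝ᵥ x) := by
        have := dotProduct_self_nonneg x
        have := specNorm_nonneg (gramOff Φ)
        gcongr

end GramMatrix

section GramDeviation

variable {m N : ℕ} {Φ : Matrix (Fin m) (Fin N) ℝ}

lemma gramDev_nonneg (Φ : Matrix (Fin m) (Fin N) ℝ) (I : Finset (Fin N)) : 0 ≤ gramDev Φ I :=
  specNorm_nonneg _

lemma gramDev_le_of_quadForm (I : Finset (Fin N)) {c : ℝ} (hc : 0 ≤ c)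
    (h : ∀ x : Fin N → ℝ, |∑ i ∈ I, ∑ j ∈ I, x i * gramOff Φ i j * x j| ≤ c * ∑ i ∈ I, x i ^ 2) :
    gramDev Φ I ≤ c := by
  have hsub : (colSub Φ I)ᵀ * colSub Φ I - 1
      = (gramOff Φ).submatrix (fun i : I => (i : Fin N)) (fun i : I => (i : Fin N)) := by
    ext i j
    simp only [gramOff, colSub, mul_apply, one_apply, Subtype.ext_iff, Matrix.sub_apply,
      transpose_apply, submatrix_apply, id]
  rw [gramDev, hsub]
  exact specNorm_submatrix_le_of_quadForm (gramOff_isHermitian Φ) I hc h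

lemma gramDev_eq_zero_of_card_eq_one (hΦ : UnitColumns Φ) {I : Finset (Fin N)} (hI : #I = 1) :
    gramDev Φ I = 0 := by
  obtain ⟨i, rfl⟩ := card_eq_one.1 hI
  refine le_antisymm (gramDev_le_of_quadForm _ le_rfl fun x => ?_) (gramDev_nonneg Φ _)
  simp [gramOff_self hΦ]

lemma gramDev_le_specNorm_sq (hΦ : UnitColumns Φ) (I : Finset (Fin N)) :
    gramDev Φ I ≤ specNorm Φ ^ 2 := by
  refine gramDev_le_of_quadForm I (sq_nonneg _) fun x => ?_
  have h := abs_dotProduct_gramOff_mulVec_le hΦ fun i => if i ∈ I then x i else 0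
  simpa [dotProduct, mulVec, mul_sum, mul_assoc, sq] using h

lemma gramDev_pow_le_expect_trace (hΦ : UnitColumns Φ) (I : Finset (Fin N)) {q : ℕ} (hq : q ≠ 0) :
    gramDev Φ I ^ (2 * q)
      ≤ 4 ^ q * 𝔼 T ∈ I.powerset, (rankOneSum (maskCol (gramOff Φ) T) (I \ T) ^ q).trace := by
  set B : ℝ := 4 ^ q * 𝔼 T ∈ I.powerset, (rankOneSum (maskCol (gramOff Φ) T) (I \ T) ^ q).trace
  have hB : 0 ≤ B := mul_nonneg (by positivity)
    (expect_nonneg fun T _ => ((rankOneSum_posSemidef _ _).pow q).trace_nonneg)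
  have h2q : 2 * q ≠ 0 := by lia
  have hroot : (B ^ ((2 * q : ℕ) : ℝ)⁻¹) ^ (2 * q) = B := Real.rpow_inv_natCast_pow hB h2q
  rw [← hroot]
  refine pow_le_pow_left₀ (gramDev_nonneg Φ I)
    (gramDev_le_of_quadForm I (by positivity) fun x => ?_) _
  refine le_of_pow_le_pow_left₀ h2q (by positivity) ?_
  rw [(even_two_mul q).pow_abs, mul_pow, hroot, mul_comm B]
  exact quadForm_pow_le_expect_trace (gramOff_self hΦ) I x hq

lemma isStRIP_of_forall_gramDev_lt {k : ℕ} {δ ε : ℝ} (hε : 0 < ε)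
    (h : ∀ I : Finset (Fin N), #I = k → gramDev Φ I < δ) : IsStRIP Φ k δ ε := by
  rw [IsStRIP, probSubset_eq_subsetProb, subsetProb, expect_eq_zero]
  · exact hε
  · exact fun I hI => Set.indicator_of_notMem (s := {I | δ ≤ gramDev Φ I})
      (not_le.2 (h I (mem_powersetCard.1 hI).2)) _

end GramDeviation

section Constants

lemma lt_of_le_exp_mul_div {y δ : ℝ} (hy : 0 < y)
    (h : y ≤ Real.exp (-1 / 4) * δ / (6 * Real.sqrt 2)) : y < δ := by
  have hexp : Real.exp (-1 / 4) ≤ 1 := Real.exp_le_one_iff.2 (by norm_num)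
  have hsqrt : 1 ≤ Real.sqrt 2 := Real.one_le_sqrt.2 one_le_two
  rw [le_div_iff₀ (by positivity)] at h
  have hδ : 0 < δ := by
    by_contra! hδ
    nlinarith [Real.exp_pos (-1 / 4)]
  nlinarith

-- `72 = (6 √2) ^ 2` and `43 √e < 72`.
lemma mul_sq_le_of_le_exp_mul_div {y δ : ℝ} (hy : 0 ≤ y)
    (h : y ≤ Real.exp (-1 / 4) * δ / (6 * Real.sqrt 2)) : 43 * y ^ 2 ≤ δ ^ 2 / Real.exp 1 := by
  have hroot : Real.exp (-1 / 4) ^ 2 ≤ 72 / 43 / Real.exp 1 := by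
    have hexp : Real.exp (1 / 2) ≤ 72 / 43 := by
      refine le_of_pow_le_pow_left₀ two_ne_zero (by norm_num) ?_
      rw [← Real.exp_nat_mul]
      norm_num
      linarith [Real.exp_one_lt_d9]
    have hsplit : Real.exp (-1 / 4) ^ 2 = Real.exp (1 / 2) / Real.exp 1 := by
      rw [← Real.exp_nat_mul, ← Real.exp_sub]
      norm_num
    rw [hsplit]
    gcongr
  calc 43 * y ^ 2 ≤ 43 * (Real.exp (-1 / 4) * δ / (6 * Real.sqrt 2)) ^ 2 := by gcongr
    _ = 43 / 72 * (Real.exp (-1 / 4) ^ 2 * δ ^ 2) := by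
        rw [div_pow, mul_pow, mul_pow, Real.sq_sqrt zero_le_two]
        ring
    _ ≤ 43 / 72 * (72 / 43 / Real.exp 1 * δ ^ 2) := by gcongr
    _ = δ ^ 2 / Real.exp 1 := by ring

lemma moment_constants_le {a b δ κ : ℝ} (ha0 : 0 ≤ a) (ha1 : a ≤ 1) (hb : 0 ≤ b) (hκ : 0 ≤ κ)
    (h : Real.sqrt b + Real.sqrt (2 * a * b) + κ ≤ Real.exp (-1 / 4) * δ / (6 * Real.sqrt 2)) :
    32 * b ≤ δ ^ 2 / Real.exp 1 ∧ 192 * (a * b) ≤ δ ^ 2 / Real.exp 1 ∧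
      36 * κ ^ 2 ≤ δ ^ 2 / Real.exp 1 := by
  have hsqrt_b := Real.sqrt_nonneg b
  have hsqrt_ab := Real.sqrt_nonneg (2 * a * b)
  have hb_sq : Real.sqrt b ^ 2 = b := Real.sq_sqrt hb
  have hab_sq : Real.sqrt (2 * a * b) ^ 2 = 2 * a * b := Real.sq_sqrt (by positivity)
  set y := Real.sqrt b + Real.sqrt (2 * a * b) + κ
  have hy0 : 0 ≤ y := by positivity
  have hyδ := mul_sq_le_of_le_exp_mul_div hy0 h
  have hb_le : b ≤ y ^ 2 := by
    rw [← hb_sq]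
    exact pow_le_pow_left₀ hsqrt_b (by linarith) 2
  have hκ_le : κ ^ 2 ≤ y ^ 2 := pow_le_pow_left₀ hκ (by linarith) 2
  have hab_le : (3 / 2 * Real.sqrt (2 * a * b)) ^ 2 ≤ y ^ 2 := by
    have hcompare : Real.sqrt (2 * a * b) ≤ 2 * Real.sqrt b := by
      refine le_of_pow_le_pow_left₀ two_ne_zero (by positivity) ?_
      rw [mul_pow, hab_sq, hb_sq]
      nlinarith
    exact pow_le_pow_left₀ (by positivity) (by linarith) 2
  rw [mul_pow, hab_sq] at hab_le
  have := sq_nonneg y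
  exact ⟨by linarith, by linarith, by linarith⟩

lemma half_le_log_one_div {ε : ℝ} (hε0 : 0 < ε) (hε : 2 * ε ≤ 1) : 1 / 2 ≤ Real.log (1 / ε) := by
  have : Real.log 2 ≤ Real.log (1 / ε) :=
    Real.log_le_log two_pos ((le_div_iff₀ hε0).2 hε)
  linarith [Real.log_two_gt_d9]

lemma exp_neg_mul_log_one_div {ε : ℝ} (hε : 0 < ε) (n : ℕ) :
    Real.exp (-(n * Real.log (1 / ε))) = ε ^ n := by
  rw [one_div, Real.log_inv, mul_neg, neg_neg, Real.exp_nat_mul, Real.exp_log hε]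

lemma log_exp_one_div {ε : ℝ} (hε : 0 < ε) :
    Real.log (Real.exp 1 / ε) = 1 + Real.log (1 / ε) := by
  rw [Real.log_div (Real.exp_pos 1).ne' hε.ne', Real.log_exp, one_div, Real.log_inv, sub_eq_add_neg]

lemma exp_neg_mul_one_add_log_one_div_le {ε x : ℝ} (hε0 : 0 < ε) (hε : 2 * ε ≤ 1) (hx : 1 ≤ x) :
    Real.exp (-(8 * (x * (1 + Real.log (1 / ε))))) ≤ ε ^ 2 / 4 := by
  have hL := half_le_log_one_div hε0 hε
  have hexpL := exp_neg_mul_log_one_div hε0 2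
  set L := Real.log (1 / ε)
  have hexp_two : Real.exp (-2) ≤ 1 / 4 := by
    rw [Real.exp_neg, ← one_div]
    refine one_div_le_one_div_of_le (by norm_num) ?_
    linarith [Real.quadratic_le_exp_of_nonneg zero_le_two]
  calc Real.exp (-(8 * (x * (1 + L)))) ≤ Real.exp (-(2 * L) + -2) :=
        Real.exp_le_exp.2 (by nlinarith)
    _ = ε ^ 2 * Real.exp (-2) := by rw [Real.exp_add, ← hexpL, Nat.cast_ofNat]
    _ ≤ ε ^ 2 * (1 / 4) := by gcongr
    _ = ε ^ 2 / 4 := by ring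

end Constants

section LargeCorrelations

variable {m N : ℕ} {Φ : Matrix (Fin m) (Fin N) ℝ}

lemma subsetProb_exists_sum_gramOff_sq_ge_le {k : ℕ} (hk : 1 ≤ k) (hkN : k ≤ N) {avg t E : ℝ}
    (havg : k * meanSqCoherence Φ ≤ avg) (ht : 0 < t) (hE0 : 0 ≤ E)
    (hE : 4 * (k * mutualCoherence Φ ^ 4) * E ≤ t ^ 2) :
    subsetProb univ k {I | ∃ j ∈ I, avg + t ≤ ∑ i ∈ I.erase j, gramOff Φ i j ^ 2}
      ≤ k * Real.exp (-E) := by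
  obtain ⟨k, rfl⟩ := Nat.exists_eq_add_of_le' hk
  have hμbar := meanSqCoherence_nonneg Φ (hk.trans hkN)
  push_cast at havg hE ⊢
  refine subsetProb_exists_sum_erase_ge_le (M := mutualCoherence Φ ^ 2)
    (x := fun i j => gramOff Φ i j ^ 2) (by simpa using hkN)
    (fun _ _ _ _ => sq_nonneg _) (fun j _ i hi => ?_) (sq_nonneg _) ht (fun j _ => ?_) ?_
  · rw [gramOff_sq Φ (ne_of_mem_erase hi)]
    exact pow_le_pow_left₀ (abs_nonneg _) (coh_le_mutualCoherence Φ (ne_of_mem_erase hi)) 2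
  · rw [card_univ, Fintype.card_fin, sum_erase_gramOff_sq]
    calc (k : ℝ) / ((N : ℝ) - 1) * ∑ i ∈ univ.erase j, coh Φ i j ^ 2
        = k * (1 / ((N : ℝ) - 1) * ∑ i ∈ univ.erase j, coh Φ i j ^ 2) := by ring
      _ ≤ k * meanSqCoherence Φ := by
          gcongr
          exact inv_mul_sum_coh_sq_le_meanSqCoherence Φ j
      _ ≤ avg := by linarith
  · have hμ0 : 0 ≤ mutualCoherence Φ ^ (2 * 2) := (even_two_mul 2).pow_nonneg _
    rw [← pow_mul]
    refine le_trans ?_ hE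
    gcongr
    exact le_add_of_nonneg_right zero_le_one

lemma subsetProb_large_correlation_le {k : ℕ} (hk : 2 ≤ k) (hkN : k ≤ N) {ε a b : ℝ} (ha : a < 1)
    (hb : 0 < b) (hε0 : 0 < ε) (hε : k * ε ≤ 1)
    (hμ : k * mutualCoherence Φ ^ 4 ≤ 1 / Real.log (1 / ε) ^ 2 *
      ((1 - a) ^ 2 * b ^ 2 / (32 * Real.log (2 * k) * Real.log (Real.exp 1 / ε))))
    (hμbar : k * meanSqCoherence Φ ≤ a * b / Real.log (1 / ε)) :
    subsetProb univ k {I | ∃ j ∈ I, b / Real.log (1 / ε) ≤ ∑ i ∈ I.erase j, gramOff Φ i j ^ 2}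
      ≤ ε / 4 := by
  have hk2 : (2 : ℝ) ≤ k := by exact_mod_cast hk
  have h2ε : 2 * ε ≤ 1 := by nlinarith
  have hL := half_le_log_one_div hε0 h2ε
  rw [log_exp_one_div hε0] at hμ
  set L := Real.log (1 / ε)
  have hlogk : 1 ≤ Real.log (2 * k) := by
    rw [Real.le_log_iff_exp_le (by positivity)]
    linarith [Real.exp_one_lt_d9]
  set E : ℝ := 8 * (Real.log (2 * k) * (1 + L)) with hE
  have hE0 : 0 ≤ E := by positivity
  have ht : 0 < (1 - a) * b / L := by
    have := sub_pos.2 ha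
    positivity
  have hEt : 4 * (k * mutualCoherence Φ ^ 4) * E ≤ ((1 - a) * b / L) ^ 2 := by
    calc 4 * (k * mutualCoherence Φ ^ 4) * E
        ≤ 4 * (1 / L ^ 2 * ((1 - a) ^ 2 * b ^ 2 / (32 * Real.log (2 * k) * (1 + L)))) * E := by
          gcongr
      _ = ((1 - a) * b / L) ^ 2 := by
          rw [hE]
          field_simp
          ring
  have hprob := subsetProb_exists_sum_gramOff_sq_ge_le (by lia) hkN hμbar ht hE0 hEt
  rw [← add_div, ← add_mul, add_sub_cancel, one_mul] at hprob
  calc _ ≤ k * Real.exp (-E) := hprob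
    _ ≤ k * (ε ^ 2 / 4) := by
        gcongr
        exact exp_neg_mul_one_add_log_one_div_le hε0 h2ε hlogk
    _ = k * ε * (ε / 4) := by ring
    _ ≤ 1 * (ε / 4) := by gcongr
    _ = ε / 4 := one_mul _

end LargeCorrelations

section LargeDeviations

variable {m N : ℕ} {Φ : Matrix (Fin m) (Fin N) ℝ}

lemma subsetProb_gramDev_ge_mul_pow_le (hΦ : UnitColumns Φ) (hN : 1 < N) {R ρ δ : ℝ} (hR : 0 ≤ R)
    (hρ : 0 ≤ ρ) (hδ : 0 ≤ δ) {q k : ℕ} (hq : 2 ≤ q) (hkρ : (k : ℝ) ≤ ρ * ((N : ℝ) - k + 1))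
    (hρN : ρ * N ≤ 2 * k) :
    subsetProb univ k {I | δ ≤ gramDev Φ I ∧ ∀ j ∈ I, ∑ i ∈ I.erase j, gramOff Φ i j ^ 2 ≤ R}
        * δ ^ (2 * q)
      ≤ 4 ^ q * (k * ((q * R) ^ q + (3 * ρ) ^ q * (k *
          ((q * (((N : ℝ) - 1) * meanSqCoherence Φ)) ^ q
            + (3 * (ρ * (specNorm Φ ^ 2) ^ 2)) ^ q)))) := by
  have hR' : 0 ≤ ((N : ℝ) - 1) * meanSqCoherence Φ :=
    mul_nonneg (sub_nonneg.2 (by exact_mod_cast hN.le)) (meanSqCoherence_nonneg Φ hN.le)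
  have hmoment := expect_expect_trace_truncCol_pow_le (S := univ) (k := k) hR hR' (sq_nonneg _) hρ
    hq (by simpa using hkρ) (by simpa using hρN)
    (fun i _ => gramOff_row_dotProduct_self_le hΦ hN i) (sum_gramOff_row_dotProduct_sq_le hΦ)
  refine (subsetProb_mul_le_expect (f := fun I => 4 ^ q *
    𝔼 T ∈ I.powerset, (rankOneSum (truncCol (gramOff Φ) R T) (I \ T) ^ q).trace) ?_ ?_).trans ?_
  · exact fun I _ => mul_nonneg (by positivity)
      (expect_nonneg fun T _ => ((rankOneSum_posSemidef _ _).pow q).trace_nonneg)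
  · rintro I - ⟨hdev, hcorr⟩
    refine (pow_le_pow_left₀ hδ hdev _).trans
      ((gramDev_pow_le_expect_trace hΦ I (by lia)).trans_eq ?_)
    congr 1
    exact expect_congr rfl fun T hT => by
      rw [rankOneSum_maskCol_eq_truncCol (mem_powerset.1 hT) hcorr]
  · rw [← mul_expect]
    gcongr

lemma subsetProb_gramDev_ge_le_exp (hΦ : UnitColumns Φ) {k q : ℕ} (hk : 1 ≤ k) (hkN : 2 * k < N)
    {R δ : ℝ} (hR : 0 ≤ R) (hδ : 0 < δ) (hq : 2 ≤ q) (hR_le : 4 * (q * R) ≤ δ ^ 2 / Real.exp 1)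
    (hμbar : 24 * (q * (k * meanSqCoherence Φ)) ≤ δ ^ 2 / Real.exp 1)
    (hnorm : 36 * (2 * (k : ℝ) / N * specNorm Φ ^ 2) ^ 2 ≤ δ ^ 2 / Real.exp 1) :
    subsetProb univ k {I | δ ≤ gramDev Φ I ∧ ∀ j ∈ I, ∑ i ∈ I.erase j, gramOff Φ i j ^ 2 ≤ R}
      ≤ 3 * k ^ 2 * Real.exp (-q) := by
  have hk' : (1 : ℝ) ≤ k := by exact_mod_cast hk
  have hkN' : 2 * (k : ℝ) < N := by exact_mod_cast hkN
  set ρ : ℝ := 2 * (k : ℝ) / N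
  have hρ0 : 0 ≤ ρ := by positivity
  have hρN : ρ * N = 2 * k := div_mul_cancel₀ _ (by linarith)
  have hprob := subsetProb_gramDev_ge_mul_pow_le hΦ (by lia) hR hρ0 hδ.le hq
    (by nlinarith) hρN.le
  set P := subsetProb univ k
    {I | δ ≤ gramDev Φ I ∧ ∀ j ∈ I, ∑ i ∈ I.erase j, gramOff Φ i j ^ 2 ≤ R}
  set R' : ℝ := ((N : ℝ) - 1) * meanSqCoherence Φ
  set Δ : ℝ := δ ^ 2 / Real.exp 1 with hΔ
  have hμbar0 := meanSqCoherence_nonneg Φ (by lia)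
  have hR'0 : 0 ≤ R' := mul_nonneg (by linarith) hμbar0
  have hR'_le : 4 * (3 * ρ * (q * R')) ≤ Δ := by
    have hρR' : ρ * R' ≤ 2 * (k * meanSqCoherence Φ) := by
      rw [← mul_assoc 2, ← hρN, mul_assoc ρ]
      gcongr
      linarith
    linarith [mul_le_mul_of_nonneg_left hρR' q.cast_nonneg (α := ℝ)]
  have hnorm' : 4 * (3 * ρ * (3 * (ρ * (specNorm Φ ^ 2) ^ 2))) ≤ Δ := by linarith
  have hΔ0 : 0 < Δ := by positivity
  have hδΔ : δ ^ (2 * q) = Δ ^ q * Real.exp q := by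
    rw [pow_mul, hΔ, div_pow, ← Real.exp_nat_mul, mul_one, div_mul_cancel₀ _ (Real.exp_pos _).ne']
  rw [Real.exp_neg, ← div_eq_mul_inv, le_div_iff₀ (Real.exp_pos _)]
  refine le_of_mul_le_mul_right ?_ (pow_pos hΔ0 q)
  calc P * Real.exp q * Δ ^ q = P * δ ^ (2 * q) := by rw [hδΔ]; ring
    _ ≤ k * (4 * (q * R)) ^ q + k ^ 2 * (4 * (3 * ρ * (q * R'))) ^ q
          + k ^ 2 * (4 * (3 * ρ * (3 * (ρ * (specNorm Φ ^ 2) ^ 2)))) ^ q := by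
        refine hprob.trans_eq ?_
        rw [mul_pow 4, mul_pow 4, mul_pow 4, mul_pow (3 * ρ), mul_pow (3 * ρ)]
        ring
    _ ≤ k * Δ ^ q + k ^ 2 * Δ ^ q + k ^ 2 * Δ ^ q := by gcongr
    _ ≤ k ^ 2 * Δ ^ q + k ^ 2 * Δ ^ q + k ^ 2 * Δ ^ q := by
        gcongr
        exact le_self_pow₀ hk' two_ne_zero
    _ = 3 * k ^ 2 * Δ ^ q := by ring

lemma subsetProb_gramDev_ge_le (hΦ : UnitColumns Φ) {k : ℕ} (hk : 2 ≤ k) (hkN : 2 * k < N)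
    {δ ε a b : ℝ} (ha0 : 0 ≤ a) (ha1 : a ≤ 1) (hb : 0 ≤ b) (hδ : 0 < δ) (hε0 : 0 < ε)
    (hε : k * ε ≤ 1) (hμbar : k * meanSqCoherence Φ ≤ a * b / Real.log (1 / ε))
    (hδ_ge : Real.sqrt b + Real.sqrt (2 * a * b) + 2 * (k : ℝ) / (N : ℝ) * specNorm Φ ^ 2
      ≤ Real.exp (-1 / 4) * δ / (6 * Real.sqrt 2)) :
    subsetProb univ k {I | δ ≤ gramDev Φ I ∧
        ∀ j ∈ I, ∑ i ∈ I.erase j, gramOff Φ i j ^ 2 ≤ b / Real.log (1 / ε)} ≤ 3 / 8 * ε := by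
  have hk2 : (2 : ℝ) ≤ k := by exact_mod_cast hk
  have hL := half_le_log_one_div hε0 (by nlinarith)
  have hexpL := exp_neg_mul_log_one_div hε0 6
  set L := Real.log (1 / ε)
  set q := ⌈6 * L⌉₊
  have hq_ge : 6 * L ≤ q := Nat.le_ceil _
  have hq_le : (q : ℝ) ≤ 8 * L := by
    linarith [Nat.ceil_lt_add_one (show 0 ≤ 6 * L by linarith)]
  have hq2 : 2 ≤ q := by
    have : (2 : ℝ) < q + 1 := by linarith
    exact Nat.lt_succ_iff.1 (by exact_mod_cast this)
  have hqL : ∀ {z : ℝ}, 0 ≤ z → q * (z / L) ≤ 8 * z := fun {z} hz => by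
    rw [mul_div_assoc', div_le_iff₀ (by linarith)]
    linarith [mul_le_mul_of_nonneg_right hq_le hz]
  obtain ⟨hb_le, hab_le, hnorm⟩ := moment_constants_le ha0 ha1 hb (by positivity) hδ_ge
  have hμbar_le : 24 * (q * (k * meanSqCoherence Φ)) ≤ δ ^ 2 / Real.exp 1 := by
    have : q * (k * meanSqCoherence Φ) ≤ q * (a * b / L) := by gcongr
    linarith [hqL (mul_nonneg ha0 hb)]
  calc _ ≤ 3 * k ^ 2 * Real.exp (-q) := subsetProb_gramDev_ge_le_exp hΦ (by lia) hkN
        (by positivity) hδ hq2 (by linarith [hqL hb]) hμbar_le hnorm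
    _ ≤ 3 * k ^ 2 * ε ^ 6 := by
        rw [← hexpL]
        gcongr
        exact_mod_cast hq_ge
    _ = 3 * (k * ε) ^ 2 * ε ^ 3 * ε := by ring
    _ ≤ 3 * 1 ^ 2 * (1 / 2) ^ 3 * ε := by
        gcongr
        nlinarith
    _ = 3 / 8 * ε := by norm_num

end LargeDeviations

end StRIP

theorem theorem1_general {m N : ℕ} {Φ : Matrix (Fin m) (Fin N) ℝ} (hΦ : StRIP.UnitColumns Φ)
    {k : ℕ} (hk : 1 ≤ k) (hkN : k ≤ N) {δ ε a b : ℝ} (ha0 : 0 ≤ a) (ha1 : a < 1) (hb : 0 < b)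
    (hε0 : 0 < ε) (hε : ε ≤ 1 / (k : ℝ))
    (hμ : (k : ℝ) * StRIP.mutualCoherence Φ ^ 4 ≤
      1 / Real.log (1 / ε) ^ 2 * ((1 - a) ^ 2 * b ^ 2 /
        (32 * Real.log (2 * (k : ℝ)) * Real.log (Real.exp 1 / ε))))
    (hμbar : (k : ℝ) * StRIP.meanSqCoherence Φ ≤ a * b / Real.log (1 / ε))
    (hab : Real.sqrt b + Real.sqrt (2 * a * b) + 2 * (k : ℝ) / (N : ℝ) * StRIP.specNorm Φ ^ 2
      ≤ Real.exp (-1 / 4) * δ / (6 * Real.sqrt 2)) :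
    StRIP.IsStRIP Φ k δ ε := by
  have hN : (0 : ℝ) < N := Nat.cast_pos.2 (hk.trans hkN)
  have hkε : k * ε ≤ 1 := by rwa [mul_comm, ← le_div_iff₀ (by positivity)]
  have hδ_gt := StRIP.lt_of_le_exp_mul_div (by positivity) hab
  have hδ : 0 < δ := lt_of_le_of_lt (by positivity) hδ_gt
  obtain rfl | hk2 := hk.eq_or_lt
  · exact StRIP.isStRIP_of_forall_gramDev_lt hε0 fun I hI => by
      rwa [StRIP.gramDev_eq_zero_of_card_eq_one hΦ hI]
  rcases lt_or_ge (2 * k) N with hkN2 | hkN2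
  · have hcorr := StRIP.subsetProb_large_correlation_le hk2 hkN ha1 hb hε0 hkε hμ hμbar
    have hdev := StRIP.subsetProb_gramDev_ge_le hΦ hk2 hkN2 ha0 ha1.le hb.le hδ hε0 hkε hμbar hab
    rw [StRIP.IsStRIP, StRIP.probSubset_eq_subsetProb]
    refine ((StRIP.subsetProb_mono fun I _ hI => ?_).trans
      StRIP.subsetProb_union_le).trans_lt (lt_of_le_of_lt (add_le_add hcorr hdev) (by linarith))
    by_cases hI_corr : ∃ j ∈ I, b / Real.log (1 / ε) ≤ ∑ i ∈ I.erase j, StRIP.gramOff Φ i j ^ 2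
    · exact Or.inl hI_corr
    · push Not at hI_corr
      exact Or.inr ⟨hI, fun j hj => (hI_corr j hj).le⟩
  · have hκ : StRIP.specNorm Φ ^ 2 ≤ 2 * (k : ℝ) / N * StRIP.specNorm Φ ^ 2 :=
      le_mul_of_one_le_left (sq_nonneg _) ((one_le_div hN).2 (by exact_mod_cast hkN2))
    refine StRIP.isStRIP_of_forall_gramDev_lt hε0 fun I _ => ?_
    linarith [StRIP.gramDev_le_specNorm_sq hΦ I, Real.sqrt_nonneg b, Real.sqrt_nonneg (2 * a * b)]

theorem theorem1 {m N : ℕ} (Φ : Matrix (Fin m) (Fin N) ℝ) (hΦ : StRIP.UnitColumns Φ)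
    (k : ℕ) (hk : 1 ≤ k) (hkN : k ≤ N) (δ ε a b c : ℝ)
    (ha : a ∈ Set.Ioo (0 : ℝ) 1) (hb : b ∈ Set.Ioo (0 : ℝ) 1) (hc : c ∈ Set.Ioo (0 : ℝ) 1)
    (hε0 : 0 < ε) (hε : ε < min (1 / (k : ℝ)) (Real.exp (1 - 1 / Real.log 2)))
    (hμ : (k : ℝ) * StRIP.mutualCoherence Φ ^ 4 ≤
      1 / Real.log (1 / ε) ^ 2 *
        min ((1 - a) ^ 2 * b ^ 2 /
          (32 * Real.log (2 * (k : ℝ)) * Real.log (Real.exp 1 / ε))) (c ^ 2))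
    (hμbar : (k : ℝ) * StRIP.meanSqCoherence Φ ≤ a * b / Real.log (1 / ε))
    (habc : Real.sqrt b + Real.sqrt (2 * a * b) + Real.sqrt c
        + 2 * (k : ℝ) / (N : ℝ) * StRIP.specNorm Φ ^ 2
      ≤ Real.exp (-1 / 4) * δ / (6 * Real.sqrt 2)) :
    StRIP.IsStRIP Φ k δ ε := by
  exact theorem1_general hΦ hk hkN ha.1.le ha.2 hb.1 hε0 (hε.le.trans (min_le_left _ _))
    (hμ.trans (mul_le_mul_of_nonneg_left (min_le_left _ _) (by positivity))) hμbar
    (by linarith [Real.sqrt_nonneg c])
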